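/- **Theorem 1.** A two-item instance of the joint replenishment problem (JRP) consists of non-negative integer coefficients $K_0,K_1,H_1,K_2,H_2$ with $H_1,H_2>0$; a solution is a pair $(q_1,q_2)$ of positive integers (replenishment periods). In the *aperiodic* JRP, where $K_0\le K_1$ and $K_0\le K_2$, one minimizes $$\frac{K_1}{q_1}+H_1q_1+\frac{K_2}{q_2}+H_2q_2-\frac{K_0}{\mathrm{lcm}(q_1,q_2)},$$ and in the *periodic* JRP, where $K_0>0$, one minimizes $$\frac{K_1}{q_1}+H_1q_1+\frac{K_2}{q_2}+H_2q_2+\frac{K_0}{\gcd(q_1,q_2)}.$$ A polynomial-time algorithm for such a problem is a Turing machine that, given the coefficients of any instance in binary, outputs an optimal pair $(q_1,q_2)$ in binary after a number of steps polynomial in the length of the input. Integer factorization can be solved in polynomial time if there are polynomial-time Turing machines (i) that decompose any given composite number $M$ into a product of two numbers smaller than $M$, and (ii) that output, for any given positive integer, its full factorization into primes (numbers being written in binary). (a) If there is a polynomial-time algorithm for the aperiodic JRP with two items, then integer factorization can be solved in polynomial time. Moreover, for every odd composite number $M$, the coefficients $K_0=K_1=M(M-1)$, $H_1=4$, $K_2=M^3(M^2-1)$,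 $H_2=M(M^2-1)$ form an instance of the aperiodic JRP, the nonzero coefficients have logarithm at most $5\log M$, an optimal solution exists, and every optimal solution $(q_1,q_2)$ satisfies $q_2=M$ and $1<\gcd(q_1,M)<M$. (b) If there is a polynomial-time algorithm for the periodic JRP with two items, then integer factorization can be solved in polynomial time. Moreover, for every odd composite number $M$, the coefficients $K_0=M$, $K_1=0$, $H_1=1$, $K_2=M^3(M+1)$, $H_2=M(M+1)$ form an instance of the periodic JRP, the nonzero coefficients have logarithm at most $5\log M$, an optimal solution exists, and every optimal solution $(q_1,q_2)$ satisfies $q_2=M$ and $1<\gcd(q_1,M)<M$. In both cases $\gcd(q_1,M)$ is therefore a nontrivial divisor of $M$. -/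

import Mathlib

/-! ### Search problems solvable in polynomial time -/

/-- A finite sequence of natural numbers as a word: every number is written in binary (least
significant bit first) and is terminated by a comma. -/
def encodeNats (l : List ℕ) : List Computability.Γ' :=
  l.flatMap fun n =>
    (Computability.encodeNat n).map Computability.Γ'.bit ++ [Computability.Γ'.comma]

/-- The search problem "given an instance `a` with `valid a`, output some `b` with `sol a b`" can be
solved in polynomial time: there is a Turing machine that, on the word `ea a` of any valid
instance `a`, halts within a number of steps polynomial in the length of `ea a` and leaves the word
`eb b` of a solution `b` on its output tape. -/
def PolyTimeSolvable {α β : Type} (ea : α → List Computability.Γ') (eb : β → List Computability.Γ')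
    (valid : α → Prop) (sol : α → β → Prop) : Prop :=
  ∃ f : {a : α // valid a} → β,
    Nonempty (Turing.TM2ComputableInPolyTime (fun a : {a : α // valid a} => ea a.1) eb f) ∧
      ∀ a : {a : α // valid a}, sol a.1 (f a)

/-! ### Integer factorization -/

/-- `M` is a composite number. -/
def IsComposite (M : ℕ) : Prop :=
  1 < M ∧ ¬ M.Prime

/-- Given a composite number, decompose it into the product of two smaller numbers. -/
def SplittingInPolyTime : Prop :=
  PolyTimeSolvable (fun M : ℕ => encodeNats [M]) (fun d : ℕ × ℕ => encodeNats [d.1, d.2])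
    IsComposite (fun M d => d.1 * d.2 = M ∧ d.1 < M ∧ d.2 < M)

/-- Given a positive integer, find its full factorization into primes. -/
def PrimeFactorizationInPolyTime : Prop :=
  PolyTimeSolvable (fun M : ℕ => encodeNats [M]) encodeNats
    (fun M => 0 < M) (fun M l => (∀ p ∈ l, p.Prime) ∧ l.prod = M)

/-- Integer factorization can be solved in polynomial time, both as the problem of splitting a
composite number and as the problem of finding the full prime factorization. -/
def IntegerFactorizationInPolyTime : Prop :=
  SplittingInPolyTime ∧ PrimeFactorizationInPolyTime

/-! ### The two-item joint replenishment problem -/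

/-- The coefficients of a two-item instance: `K₀` is the item-independent coefficient (joint discount
or joint cost), `Kᵢ` and `Hᵢ` are the fixed ordering cost and the holding cost of item `i`. -/
structure TwoItemJRP where
  K₀ : ℕ
  K₁ : ℕ
  H₁ : ℕ
  K₂ : ℕ
  H₂ : ℕ

namespace TwoItemJRP

/-- The list of all coefficients. -/
def coeffs (I : TwoItemJRP) : List ℕ :=
  [I.K₀, I.K₁, I.H₁, I.K₂, I.H₂]

/-- The average cost `K / q + H * q` of a single item that is ordered every `q` units of time. -/
def eoq (q K H : ℕ) : ℚ :=
  (K : ℚ) / q + (H : ℚ) * q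

/-- The objective of the aperiodic problem: the discount `K₀` is granted whenever both items are
ordered at the same time. -/
def aperiodicCost (I : TwoItemJRP) (q₁ q₂ : ℕ) : ℚ :=
  eoq q₁ I.K₁ I.H₁ + eoq q₂ I.K₂ I.H₂ - (I.K₀ : ℚ) / (Nat.lcm q₁ q₂ : ℕ)

/-- The objective of the periodic problem: the joint cost `K₀` is charged at every multiple
of `gcd q₁ q₂`. -/
def periodicCost (I : TwoItemJRP) (q₁ q₂ : ℕ) : ℚ :=
  eoq q₁ I.K₁ I.H₁ + eoq q₂ I.K₂ I.H₂ + (I.K₀ : ℚ) / (Nat.gcd q₁ q₂ : ℕ)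

/-- Admissible coefficients for the aperiodic problem: positive holding costs, and a discount that
exceeds neither of the two fixed costs. -/
def IsAperiodicInstance (I : TwoItemJRP) : Prop :=
  0 < I.H₁ ∧ 0 < I.H₂ ∧ I.K₀ ≤ I.K₁ ∧ I.K₀ ≤ I.K₂

/-- Admissible coefficients for the periodic problem: positive holding costs and a positive joint
ordering cost. -/
def IsPeriodicInstance (I : TwoItemJRP) : Prop :=
  0 < I.H₁ ∧ 0 < I.H₂ ∧ 0 < I.K₀

/-- `(q₁, q₂)` minimizes `cost` over all pairs of positive integers. -/
def IsOptimal (cost : ℕ → ℕ → ℚ) (q₁ q₂ : ℕ) : Prop :=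
  0 < q₁ ∧ 0 < q₂ ∧ ∀ r₁ r₂ : ℕ, 0 < r₁ → 0 < r₂ → cost q₁ q₂ ≤ cost r₁ r₂

/-- The two-item aperiodic problem (find an optimal pair of periods) is solvable in polynomial
time. -/
def AperiodicInPolyTime : Prop :=
  PolyTimeSolvable (fun I : TwoItemJRP => encodeNats I.coeffs)
    (fun q : ℕ × ℕ => encodeNats [q.1, q.2])
    IsAperiodicInstance (fun I q => IsOptimal I.aperiodicCost q.1 q.2)

/-- The two-item periodic problem (find an optimal pair of periods) is solvable in polynomial
time. -/
def PeriodicInPolyTime : Prop :=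
  PolyTimeSolvable (fun I : TwoItemJRP => encodeNats I.coeffs)
    (fun q : ℕ × ℕ => encodeNats [q.1, q.2])
    IsPeriodicInstance (fun I q => IsOptimal I.periodicCost q.1 q.2)

/-- The aperiodic instance associated with `M`. -/
def aperiodicInstance (M : ℕ) : TwoItemJRP where
  K₀ := M * (M - 1)
  K₁ := M * (M - 1)
  H₁ := 4
  K₂ := M ^ 3 * (M ^ 2 - 1)
  H₂ := M * (M ^ 2 - 1)

/-- The periodic instance associated with `M`. -/
def periodicInstance (M : ℕ) : TwoItemJRP where
  K₀ := M
  K₁ := 0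
  H₁ := 1
  K₂ := M ^ 3 * (M + 1)
  H₂ := M * (M + 1)

/-- All coefficients of `I` have size at most `5 log M`. -/
def SizeBound (I : TwoItemJRP) (M : ℕ) : Prop :=
  ∀ c ∈ I.coeffs, Real.logb 2 c ≤ 5 * Real.logb 2 M

/-- The problem with objective `cost` has an optimal solution, and every optimal solution has second
period `M` and a first period that shares with `M` a nontrivial divisor of `M`. -/
def ForcesDivisor (cost : ℕ → ℕ → ℚ) (M : ℕ) : Prop :=
  (∃ q₁ q₂ : ℕ, IsOptimal cost q₁ q₂) ∧
    ∀ q₁ q₂ : ℕ, IsOptimal cost q₁ q₂ → q₂ = M ∧ 1 < Nat.gcd q₁ M ∧ Nat.gcd q₁ M < M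

end TwoItemJRP

/-!
Both parts rest on one elementary computation. Let `M` be an odd composite number. The second item of
the instance is so expensive that its period must be `q₂ = M` in an optimal solution. What remains is a
function of `q₁` and `gcd q₁ M`, and the coefficients are balanced such that a nontrivial gcd is
cheaper than a trivial one, and that the best `q₁` reveals a divisor: `2 * q₁ + gcd q₁ M = M` in the
aperiodic case and `q₁ = gcd q₁ M` in the periodic case
(`TwoItemJRP.IsOptimal.of_aperiodicInstance`, `TwoItemJRP.IsOptimal.of_periodicInstance`). So
`M - 2 * q₁`, or `q₁`, is a nontrivial divisor of `M`, and the reduction does not even have to compute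
a greatest common divisor.

The instance is valid also if `M` is an odd prime, and its solution then yields some candidate for a
divisor, too. A division tells whether the candidate is a nontrivial divisor; if it is not,
then `M` is prime. Thus one call of the machine for the replenishment problem either splits `M` or
proves its primality (`Prog.IsDivisorFinder.exec_split`). The full factorization descends from `M`
along nontrivial divisors to a prime divisor, which takes at most `log M` calls, and divides it out,
which happens at most `log M` times (`Prog.IsDivisorFinder.exec_findPrime`,
`Prog.IsDivisorFinder.exec_loop_extractPrime`).

To turn this into Turing machines, a small language of structured programs over named stacks
(`Prog`) is compiled to Mathlib's `Turing.FinTM2`. A program is given by code with a parametric type of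
labels, so that sequencing, branching and looping only embed labels, and `Prog.Exec F s s' t` says
that `F` takes the stack contents `s` to `s'` within `t` steps in every machine that contains its
code. The given machine for the replenishment problem is itself one of these programs
(`Prog.exec_call`): its stacks are added to the registers. A number is kept in binary in a register,
and the programs for addition, subtraction, multiplication and division take quadratic time in the
number of digits. A program for a search problem yields polynomial time solvability by
`polyTimeSolvable_of_exec`.
-/

open Computability Turing Function

/-! ### Programs on stacks with calls to a given machine -/

/-- What a basic step of a program does to one stack. -/
inductive StackAction
  | keep
  | pop
  | push (a : Γ')

/-- The effect of an action on the contents of a stack. -/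
def StackAction.apply : StackAction → List Γ' → List Γ'
  | keep, l => l
  | pop, l => l.tail
  | push a, l => a :: l

@[simp] theorem StackAction.apply_keep (l : List Γ') : keep.apply l = l := rfl

@[simp] theorem StackAction.apply_pop (l : List Γ') : pop.apply l = l.tail := rfl

@[simp] theorem StackAction.apply_push (a : Γ') (l : List Γ') : (push a).apply l = a :: l := rfl

/-- The function that reads off the top symbols of all stacks. -/
def tops {V : Type} (s : V → List Γ') (v : V) : Option Γ' := (s v).head?

section Machine

variable (tm : FinTM2) (V : Type) [DecidableEq V] [Fintype V]

/-- The stacks of a program are those of the machine `tm`, and one stack over `Γ'` for every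
register in `V`. -/
abbrev StackAlphabet : tm.K ⊕ V → Type
  | .inl k => tm.Γ k
  | .inr _ => Γ'

/-- The finite memory of a program: a state of `tm`, and one symbol read from each register. -/
abbrev ProgMem := tm.σ × (V → Option Γ')

/-- The statements of a program, with jumps to labels in `Λ`. -/
abbrev ProgStmt (Λ : Type) := TM2.Stmt (StackAlphabet tm V) Λ (ProgMem tm V)

/-- The contents of all stacks. -/
abbrev ProgStacks := ∀ k, List (StackAlphabet tm V k)

/-- A program with one entry and one exit. Its code is parametric in the label type `Λ'` of the
machine into which it is built: given where its own labels are placed and to which label it has to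
exit, it provides the statement of each of its labels. Sequencing and loops are then obtained by
choosing the exit labels, and no statement has to be relabelled. -/
structure Prog where
  Λ : Type
  [fin : Fintype Λ]
  entry : Λ
  code : ∀ {Λ' : Type}, (Λ → Λ') → Λ' → Λ → ProgStmt tm V Λ'

attribute [instance] Prog.fin

variable {tm V}

/-- Stack contents given separately for the machine `tm` and for the registers. -/
def joinStacks (o : ∀ k, List (tm.Γ k)) (s : V → List Γ') : ProgStacks tm V
  | .inl k => o k
  | .inr v => s v

/-- Wherever the program is placed, it leads from stacks `S` to stacks `S'` in at most `t` steps. -/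
def Prog.Runs (F : Prog tm V) (S S' : ProgStacks tm V) (t : ℕ) : Prop :=
  ∀ (Λ' : Type) (emb : F.Λ → Λ') (exit : Λ') (M : Λ' → ProgStmt tm V Λ'),
    (∀ l, M (emb l) = F.code emb exit l) → ∀ v, ∃ v', ∃ t' ≤ t,
      (flip bind (TM2.step M))^[t'] (some ⟨some (emb F.entry), v, S⟩) =
        some ⟨some exit, v', S'⟩

/-- The program leads from register contents `s` to `s'` in at most `t` steps, the stacks of `tm`
being empty before and after. -/
def Prog.Exec (F : Prog tm V) (s s' : V → List Γ') (t : ℕ) : Prop :=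
  F.Runs (joinStacks (fun _ => []) s) (joinStacks (fun _ => []) s') t

namespace Prog

/-- Read the top symbols of the registers in a list into the memory. -/
def readTops {Λ : Type} (l : List V) (q : ProgStmt tm V Λ) : ProgStmt tm V Λ :=
  l.foldr (fun v q => .peek (.inr v) (fun m a => (m.1, update m.2 v a)) q) q

/-- Perform an action, depending on the symbols in the memory, on each register in a list. -/
def doActions {Λ : Type} (a : (V → Option Γ') → V → StackAction) (l : List V)
    (q : ProgStmt tm V Λ) : ProgStmt tm V Λ :=
  l.foldr (fun v q =>
    .branch (fun m => match a m.2 v with | .pop => true | _ => false)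
      (.pop (.inr v) (fun m _ => m) q)
      (.branch (fun m => match a m.2 v with | .push _ => true | _ => false)
        (.push (.inr v) (fun m => match a m.2 v with | .push b => b | _ => Γ'.blank) q) q)) q

omit [Fintype V] in
theorem stepAux_readTops {Λ : Type} (l : List V) (q : ProgStmt tm V Λ) (m : ProgMem tm V)
    (o : ∀ k, List (tm.Γ k)) (s : V → List Γ') :
    TM2.stepAux (readTops l q) m (joinStacks o s) =
      TM2.stepAux q (m.1, fun w => if w ∈ l then tops s w else m.2 w) (joinStacks o s) := by
  induction l generalizing m with
  | nil => simp [readTops]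
  | cons v l ih =>
    rw [readTops, List.foldr_cons, TM2.stepAux, ← readTops, ih]
    congr 2
    funext w
    by_cases hw : w ∈ l
    · simp [hw]
    · by_cases hv : w = v
      · subst hv
        simp only [hw, List.mem_cons, or_false, if_true, if_false]
        exact update_self ..
      · simp only [hw, hv, List.mem_cons, or_false, if_false]
        exact update_of_ne hv ..

omit [Fintype V] in
theorem update_joinStacks (o : ∀ k, List (tm.Γ k)) (s : V → List Γ') (v : V) (l : List Γ') :
    update (joinStacks o s) (.inr v) l = joinStacks o (update s v l) := by
  funext k
  rcases k with k | w
  · exact update_of_ne (by simp) ..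
  · by_cases h : w = v
    · subst h
      exact (update_self ..).trans (update_self (β := fun _ => List Γ') w l s).symm
    · exact (update_of_ne (by simpa using h) ..).trans
        (update_of_ne (β := fun _ => List Γ') h l s).symm

omit [Fintype V] in
theorem update_joinStacks_inl (o : ∀ k, List (tm.Γ k)) (s : V → List Γ') (k : tm.K)
    (l : List (tm.Γ k)) :
    update (joinStacks o s) (.inl k) l = joinStacks (update o k l) s := by
  funext j
  rcases j with j | w
  · by_cases h : j = k
    · subst h
      exact (update_self ..).trans (update_self (β := fun k => List (tm.Γ k)) j l o).symm
    · exact (update_of_ne (by simpa using h) ..).trans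
        (update_of_ne (β := fun k => List (tm.Γ k)) h l o).symm
  · exact update_of_ne (by simp) ..

omit [Fintype V] in
theorem stepAux_doActions {Λ : Type} (a : (V → Option Γ') → V → StackAction) (l : List V)
    (hl : l.Nodup) (q : ProgStmt tm V Λ) (m : ProgMem tm V) (o : ∀ k, List (tm.Γ k))
    (s : V → List Γ') :
    TM2.stepAux (doActions a l q) m (joinStacks o s) =
      TM2.stepAux q m
        (joinStacks o fun w => if w ∈ l then (a m.2 w).apply (s w) else s w) := by
  induction l generalizing s with
  | nil => simp [doActions]
  | cons v l ih =>
    have hv : v ∉ l := (List.nodup_cons.1 hl).1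
    have key : ∀ x : List Γ', x = (a m.2 v).apply (s v) →
        TM2.stepAux (doActions a l q) m (joinStacks o (update s v x)) =
        TM2.stepAux q m
          (joinStacks o fun w => if w ∈ v :: l then (a m.2 w).apply (s w) else s w) := by
      rintro x rfl
      rw [ih (List.nodup_cons.1 hl).2]
      congr 2
      funext w
      by_cases hw : w = v
      · subst hw; simp [hv]
      · simp [hw]
    rw [doActions, List.foldr_cons, ← doActions]
    rcases h : a m.2 v with _ | _ | b
    · simpa [h] using key (s v) (by simp [h, StackAction.apply])
    · rw [← key (s v).tail (by simp [h, StackAction.apply]), ← update_joinStacks]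
      simp only [TM2.stepAux, h, cond_true]
      rfl
    · rw [← key (b :: s v) (by simp [h, StackAction.apply]), ← update_joinStacks]
      simp only [TM2.stepAux, h, cond_true, cond_false]
      rfl

/-- A single step: read all top symbols and, depending on them, act on all registers. -/
noncomputable def step (tm : FinTM2) (a : (V → Option Γ') → V → StackAction) : Prog tm V where
  Λ := Unit
  entry := ()
  code _ exit _ := readTops Finset.univ.toList
    (doActions a Finset.univ.toList (.goto fun _ => exit))

/-- Run one program, then another. -/
def seq (F G : Prog tm V) : Prog tm V where
  Λ := F.Λ ⊕ G.Λ
  entry := .inl F.entry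
  code emb exit
    | .inl l => F.code (emb ∘ .inl) (emb (.inr G.entry)) l
    | .inr l => G.code (emb ∘ .inr) exit l

/-- Run one of two programs, depending on the top symbols. -/
noncomputable def ite (g : (V → Option Γ') → Bool) (F G : Prog tm V) : Prog tm V where
  Λ := Option (F.Λ ⊕ G.Λ)
  entry := none
  code emb exit
    | none => readTops Finset.univ.toList
        (.branch (fun m => g m.2) (.goto fun _ => emb (some (.inl F.entry)))
          (.goto fun _ => emb (some (.inr G.entry))))
    | some (.inl l) => F.code (emb ∘ some ∘ .inl) exit l
    | some (.inr l) => G.code (emb ∘ some ∘ .inr) exit l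

/-- Repeat a program as long as a condition on the top symbols holds. -/
noncomputable def loop (g : (V → Option Γ') → Bool) (F : Prog tm V) : Prog tm V where
  Λ := Option F.Λ
  entry := none
  code emb exit
    | none => readTops Finset.univ.toList
        (.branch (fun m => g m.2) (.goto fun _ => emb (some F.entry)) (.goto fun _ => exit))
    | some l => F.code (emb ∘ some) (emb none) l

omit [Fintype V] in
theorem Runs.seq {F G : Prog tm V} {S S₁ S₂ : ProgStacks tm V} {t₁ t₂ : ℕ}
    (hF : F.Runs S S₁ t₁) (hG : G.Runs S₁ S₂ t₂) : (F.seq G).Runs S S₂ (t₁ + t₂) := by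
  intro Λ' emb exit M hM v
  obtain ⟨v₁, u₁, hu₁, h₁⟩ := hF Λ' (emb ∘ .inl) (emb (.inr G.entry)) M
    (fun l => hM (.inl l)) v
  obtain ⟨v₂, u₂, hu₂, h₂⟩ := hG Λ' (emb ∘ .inr) exit M (fun l => hM (.inr l)) v₁
  refine ⟨v₂, u₂ + u₁, by omega, ?_⟩
  rw [iterate_add_apply]
  exact (congrArg _ h₁).trans h₂

omit [Fintype V] in
theorem Exec.seq {F G : Prog tm V} {s s₁ s₂ : V → List Γ'} {t₁ t₂ : ℕ}
    (hF : F.Exec s s₁ t₁) (hG : G.Exec s₁ s₂ t₂) : (F.seq G).Exec s s₂ (t₁ + t₂) :=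
  Runs.seq hF hG

omit [Fintype V] in
theorem Exec.mono {F : Prog tm V} {s s' : V → List Γ'} {t t' : ℕ}
    (h : F.Exec s s' t) (ht : t ≤ t') : F.Exec s s' t' := by
  intro Λ' emb exit M hM v
  obtain ⟨v', u, hu, h⟩ := h Λ' emb exit M hM v
  exact ⟨v', u, hu.trans ht, h⟩

theorem exec_step (a : (V → Option Γ') → V → StackAction) (s : V → List Γ') :
    (step tm a).Exec s (fun v => (a (tops s) v).apply (s v)) 1 := by
  intro Λ' emb exit M hM v
  refine ⟨(v.1, tops s), 1, le_rfl, ?_⟩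
  have h := hM ()
  simp only [step] at h
  simp only [iterate_one, flip, Option.bind_eq_bind, Option.bind_some, step, TM2.step, h,
    stepAux_readTops, stepAux_doActions _ _ (Finset.nodup_toList _)]
  simp

theorem Exec.ite_true {g : (V → Option Γ') → Bool} {F G : Prog tm V} {s s' : V → List Γ'} {t : ℕ}
    (hg : g (tops s) = true) (hF : F.Exec s s' t) : (ite g F G).Exec s s' (t + 1) := by
  intro Λ' emb exit M hM v
  obtain ⟨v₁, u₁, hu₁, h₁⟩ := hF Λ' (emb ∘ some ∘ .inl) exit M
    (fun l => hM (some (.inl l))) (v.1, tops s)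
  refine ⟨v₁, u₁ + 1, by omega, ?_⟩
  rw [iterate_add_apply, ← h₁]
  have h := hM none
  simp only [ite] at h
  simp only [iterate_one, flip, Option.bind_eq_bind, Option.bind_some, ite, TM2.step, h,
    stepAux_readTops]
  simp [hg]
  rfl

theorem Exec.ite_false {g : (V → Option Γ') → Bool} {F G : Prog tm V} {s s' : V → List Γ'}
    {t : ℕ} (hg : g (tops s) = false) (hG : G.Exec s s' t) : (ite g F G).Exec s s' (t + 1) := by
  intro Λ' emb exit M hM v
  obtain ⟨v₁, u₁, hu₁, h₁⟩ := hG Λ' (emb ∘ some ∘ .inr) exit M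
    (fun l => hM (some (.inr l))) (v.1, tops s)
  refine ⟨v₁, u₁ + 1, by omega, ?_⟩
  rw [iterate_add_apply, ← h₁]
  have h := hM none
  simp only [ite] at h
  simp only [iterate_one, flip, Option.bind_eq_bind, Option.bind_some, ite, TM2.step, h,
    stepAux_readTops]
  simp [hg]
  rfl

theorem Exec.loop_false {g : (V → Option Γ') → Bool} {F : Prog tm V} {s : V → List Γ'}
    (hg : g (tops s) = false) : (loop g F).Exec s s 1 := by
  intro Λ' emb exit M hM v
  refine ⟨(v.1, tops s), 1, le_rfl, ?_⟩
  have h := hM none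
  simp only [loop] at h
  simp only [iterate_one, flip, Option.bind_eq_bind, Option.bind_some, loop, TM2.step, h,
    stepAux_readTops]
  simp [hg]

theorem Exec.loop_true {g : (V → Option Γ') → Bool} {F : Prog tm V} {s s₁ s₂ : V → List Γ'}
    {t₁ t₂ : ℕ} (hg : g (tops s) = true) (hF : F.Exec s s₁ t₁) (hL : (loop g F).Exec s₁ s₂ t₂) :
    (loop g F).Exec s s₂ (t₁ + t₂ + 1) := by
  intro Λ' emb exit M hM v
  obtain ⟨v₁, u₁, hu₁, h₁⟩ := hF Λ' (emb ∘ some) (emb none) M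
    (fun l => hM (some l)) (v.1, tops s)
  obtain ⟨v₂, u₂, hu₂, h₂⟩ := hL Λ' emb exit M hM v₁
  refine ⟨v₂, u₂ + (u₁ + 1), by omega, ?_⟩
  have h₀ : (flip bind (TM2.step M))^[1] (some ⟨some (emb (loop g F).entry), v,
      joinStacks (fun _ => []) s⟩) = some ⟨some ((emb ∘ some) F.entry), (v.1, tops s),
      joinStacks (fun _ => []) s⟩ := by
    have h := hM none
    simp only [loop] at h
    simp only [iterate_one, flip, Option.bind_eq_bind, Option.bind_some, loop, TM2.step, h,
      stepAux_readTops]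
    simp [hg]
    rfl
  rw [iterate_add_apply, iterate_add_apply, h₀, h₁]
  exact h₂

end Prog

end Machine

/-! ### Calling the given machine as a subroutine -/

namespace Prog

section Call

variable {tm : FinTM2} {V : Type} [DecidableEq V]

/-- A statement of the machine `tm` as a statement of a program. Halting becomes a jump to
the exit. -/
def liftStmt {Λ' : Type} (emb : tm.Λ → Λ') (exit : Λ') :
    TM2.Stmt tm.Γ tm.Λ tm.σ → ProgStmt tm V Λ'
  | .push k f q => .push (.inl k) (fun m => f m.1) (liftStmt emb exit q)
  | .peek k f q => .peek (.inl k) (fun m a => (f m.1 a, m.2)) (liftStmt emb exit q)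
  | .pop k f q => .pop (.inl k) (fun m a => (f m.1 a, m.2)) (liftStmt emb exit q)
  | .load f q => .load (fun m => (f m.1, m.2)) (liftStmt emb exit q)
  | .branch f q₁ q₂ => .branch (fun m => f m.1) (liftStmt emb exit q₁) (liftStmt emb exit q₂)
  | .goto f => .goto (fun m => emb (f m.1))
  | .halt => .goto (fun _ => exit)

/-- A configuration of `tm` as a configuration of a program with register contents `s`. -/
def liftCfg {Λ' : Type} (emb : tm.Λ → Λ') (exit : Λ') (w : V → Option Γ') (s : V → List Γ')
    (c : TM2.Cfg tm.Γ tm.Λ tm.σ) : TM2.Cfg (StackAlphabet tm V) Λ' (ProgMem tm V) :=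
  ⟨some (c.l.elim exit emb), (c.var, w), joinStacks c.stk s⟩

theorem stepAux_liftStmt {Λ' : Type} (emb : tm.Λ → Λ') (exit : Λ') (w : V → Option Γ')
    (s : V → List Γ') (q : TM2.Stmt tm.Γ tm.Λ tm.σ) (v : tm.σ) (o : ∀ k, List (tm.Γ k)) :
    TM2.stepAux (liftStmt emb exit q) (v, w) (joinStacks o s) =
      liftCfg emb exit w s (TM2.stepAux q v o) := by
  induction q generalizing v o with
  | push k f q ih =>
    rw [TM2.stepAux, ← ih, ← update_joinStacks_inl]; rfl
  | peek k f q ih =>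
    rw [TM2.stepAux, ← ih]; rfl
  | pop k f q ih =>
    rw [TM2.stepAux, ← ih, ← update_joinStacks_inl]; rfl
  | load f q ih => rw [TM2.stepAux, ← ih]; rfl
  | branch f q₁ q₂ ih₁ ih₂ =>
    rw [TM2.stepAux, liftStmt, TM2.stepAux, ih₁, ih₂]
    cases f v <;> rfl
  | goto f => rfl
  | halt => rfl

theorem iterate_step_liftCfg {Λ' : Type} (emb : tm.Λ → Λ') (exit : Λ') (w : V → Option Γ')
    (s : V → List Γ') (M : Λ' → ProgStmt tm V Λ') (hM : ∀ l, M (emb l) = liftStmt emb exit (tm.m l))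
    (t : ℕ) (c c' : TM2.Cfg tm.Γ tm.Λ tm.σ)
    (h : (flip bind (TM2.step tm.m))^[t] (some c) = some c') :
    (flip bind (TM2.step M))^[t] (some (liftCfg emb exit w s c)) =
      some (liftCfg emb exit w s c') := by
  induction t generalizing c with
  | zero =>
    simp only [iterate_zero, id_eq, Option.some.injEq] at h ⊢
    rw [h]
  | succ t ih =>
    rw [iterate_succ_apply] at h ⊢
    obtain ⟨_ | l, v, o⟩ := c
    · exfalso
      have h0 : ∀ t, (flip bind (TM2.step tm.m))^[t] none = none := fun t => by
        induction t with
        | zero => rfl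
        | succ t ih => rw [iterate_succ_apply]; exact ih
      have h1 : (flip bind (TM2.step tm.m)) (some ⟨none, v, o⟩) = none := rfl
      rw [h1, h0] at h
      simp at h
    · have h1 : (flip bind (TM2.step tm.m)) (some ⟨some l, v, o⟩) =
        some (TM2.stepAux (tm.m l) v o) := rfl
      have h2 : (flip bind (TM2.step M)) (some (liftCfg emb exit w s ⟨some l, v, o⟩)) =
          some (liftCfg emb exit w s (TM2.stepAux (tm.m l) v o)) := by
        rw [← stepAux_liftStmt, ← hM]; rfl
      rw [h1] at h
      rw [h2]
      exact ih _ h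

/-- Run the machine `tm` from its initial state on the current contents of its stacks. -/
def runMachine (tm : FinTM2) (V : Type) : Prog tm V where
  Λ := Option tm.Λ
  fin := haveI := tm.ΛFin; inferInstance
  entry := none
  code emb exit
    | none => .load (fun m => (tm.initialState, m.2)) (.goto fun _ => emb (some tm.main))
    | some l => liftStmt (emb ∘ some) exit (tm.m l)

theorem initList_eq (tm : FinTM2) (l : List (tm.Γ tm.k₀)) :
    initList tm l = ⟨some tm.main, tm.initialState, update (fun _ => []) tm.k₀ l⟩ := by
  rw [initList]
  congr 1
  funext k
  by_cases h : k = tm.k₀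
  · subst h; simp
  · simp [h]

theorem haltList_eq (tm : FinTM2) (l : List (tm.Γ tm.k₁)) :
    haltList tm l = ⟨none, tm.initialState, update (fun _ => []) tm.k₁ l⟩ := by
  rw [haltList]
  congr 1
  funext k
  by_cases h : k = tm.k₁
  · subst h; simp
  · simp [h]

/-- The output convention of Mathlib's machines, which requires that all stacks but the output stack
are empty at the end, makes it possible to call the machine repeatedly. -/
theorem runs_runMachine {l : List (tm.Γ tm.k₀)} {l' : List (tm.Γ tm.k₁)} {t : ℕ}
    (h : TM2OutputsInTime tm l (some l') t) (s : V → List Γ') :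
    (runMachine tm V).Runs (joinStacks (update (fun _ => []) tm.k₀ l) s)
      (joinStacks (update (fun _ => []) tm.k₁ l') s) (t + 1) := by
  intro Λ' emb exit M hM v
  have hit := h.evals_in_steps
  simp only [initList_eq, Option.map_some, haltList_eq] at hit
  have := iterate_step_liftCfg (emb ∘ some) exit v.2 s M (fun l => hM (some l)) h.steps _ _ hit
  refine ⟨(tm.initialState, v.2), h.steps + 1, by have := h.steps_le_m; omega, ?_⟩
  rw [iterate_succ_apply]
  have h0 := hM none
  simp only [runMachine] at h0
  have h1 : (flip bind (TM2.step M)) (some ⟨some (emb (runMachine tm V).entry), v,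
      joinStacks (update (fun _ => []) tm.k₀ l) s⟩) = some (liftCfg (emb ∘ some) exit v.2 s
        ⟨some tm.main, tm.initialState, update (fun _ => []) tm.k₀ l⟩) := by
    simp only [flip, Option.bind_eq_bind, Option.bind_some, runMachine, TM2.step, h0]
    rfl
  rw [h1]
  exact this

/-- Move the contents of a register to the input stack of `tm`, in reverse order. -/
def feed (e : tm.Γ tm.k₀ ≃ Γ') (r : V) : Prog tm V where
  Λ := Unit
  entry := ()
  code emb exit _ :=
    .pop (.inr r) (fun m a => (m.1, update m.2 r a))
      (.branch (fun m => (m.2 r).isSome)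
        (.push (.inl tm.k₀) (fun m => e.symm ((m.2 r).getD Γ'.blank)) (.goto fun _ => emb ()))
        (.goto fun _ => exit))

/-- Move the contents of the output stack of `tm` to a register, in reverse order. -/
def fetch (e : tm.Γ tm.k₁ ≃ Γ') (r : V) : Prog tm V where
  Λ := Unit
  entry := ()
  code emb exit _ :=
    .pop (.inl tm.k₁) (fun m a => (m.1, update m.2 r (a.map e)))
      (.branch (fun m => (m.2 r).isSome)
        (.push (.inr r) (fun m => (m.2 r).getD Γ'.blank) (.goto fun _ => emb ()))
        (.goto fun _ => exit))

theorem runs_feed (e : tm.Γ tm.k₀ ≃ Γ') (r : V) (l : List Γ') (s : V → List Γ')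
    (o : List (tm.Γ tm.k₀)) :
    (feed e r).Runs (joinStacks (update (fun _ => []) tm.k₀ o) (update s r l))
      (joinStacks (update (fun _ => []) tm.k₀ ((l.map e.symm).reverse ++ o)) (update s r []))
      (l.length + 1) := by
  intro Λ' emb exit M hM v
  have h0 := hM ()
  simp only [feed] at h0
  induction l generalizing o v with
  | nil =>
    refine ⟨(v.1, update v.2 r none), 1, by simp, ?_⟩
    simp only [iterate_one, flip, Option.bind_eq_bind, Option.bind_some, feed, TM2.step, h0,
      TM2.stepAux]
    simp [joinStacks, update_joinStacks]
  | cons a l ih =>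
    obtain ⟨v', t, ht, h⟩ := ih (e.symm a :: o) (v.1, update v.2 r (some a))
    refine ⟨v', t + 1, by simpa using ht, ?_⟩
    rw [iterate_succ_apply]
    have h1 : (flip bind (TM2.step M)) (some ⟨some (emb (feed e r).entry), v,
        joinStacks (update (fun _ => []) tm.k₀ o) (update s r (a :: l))⟩) =
        some ⟨some (emb (feed e r).entry), (v.1, update v.2 r (some a)),
          joinStacks (update (fun _ => []) tm.k₀ (e.symm a :: o)) (update s r l)⟩ := by
      simp only [flip, Option.bind_eq_bind, Option.bind_some, feed, TM2.step, h0,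
        TM2.stepAux]
      simp [joinStacks, update_joinStacks, update_joinStacks_inl]
    rw [h1, h]
    simp

theorem runs_fetch (e : tm.Γ tm.k₁ ≃ Γ') (r : V) (l : List Γ') (s : V → List Γ')
    (o : List (tm.Γ tm.k₁)) :
    (fetch e r).Runs (joinStacks (update (fun _ => []) tm.k₁ o) (update s r l))
      (joinStacks (fun _ => []) (update s r ((o.map e).reverse ++ l))) (o.length + 1) := by
  intro Λ' emb exit M hM v
  have h0 := hM ()
  simp only [fetch] at h0
  induction o generalizing l v with
  | nil =>
    refine ⟨(v.1, update v.2 r none), 1, by simp, ?_⟩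
    simp only [iterate_one, flip, Option.bind_eq_bind, Option.bind_some, fetch, TM2.step, h0,
      TM2.stepAux]
    simp [joinStacks, update_joinStacks_inl]
  | cons a o ih =>
    obtain ⟨v', t, ht, h⟩ := ih (e a :: l) (v.1, update v.2 r (some (e a)))
    refine ⟨v', t + 1, by simpa using ht, ?_⟩
    rw [iterate_succ_apply]
    have h1 : (flip bind (TM2.step M)) (some ⟨some (emb (fetch e r).entry), v,
        joinStacks (update (fun _ => []) tm.k₁ (a :: o)) (update s r l)⟩) =
        some ⟨some (emb (fetch e r).entry), (v.1, update v.2 r (some (e a))),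
          joinStacks (update (fun _ => []) tm.k₁ o) (update s r (e a :: l))⟩ := by
      simp only [flip, Option.bind_eq_bind, Option.bind_some, fetch, TM2.step, h0,
        TM2.stepAux]
      simp [joinStacks, update_joinStacks, update_joinStacks_inl]
    rw [h1, h]
    simp

end Call

end Prog

/-! ### From programs to polynomial time computability -/

section Solvable

variable {tm : FinTM2} {V : Type} [DecidableEq V] [Fintype V]

namespace Prog

/-- A program as a machine with input register `i` and output register `o`. The label `none` resets
the memory and halts. -/
def toFinTM2 (F : Prog tm V) (i o : V) : FinTM2 :=
  haveI := tm.kFin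
  haveI := tm.σFin
  { K := tm.K ⊕ V
    k₀ := .inr i
    k₁ := .inr o
    Γ := StackAlphabet tm V
    Λ := Option F.Λ
    main := some F.entry
    σ := ProgMem tm V
    initialState := (tm.initialState, fun _ => none)
    Γk₀Fin := inferInstanceAs (Fintype Γ')
    m := fun
      | none => .load (fun _ => (tm.initialState, fun _ => none)) .halt
      | some l => F.code some none l }

omit [Fintype V] in
theorem update_inr_eq_joinStacks (i : V) (w : List Γ') :
    (update (fun _ => []) (.inr i) w : ProgStacks tm V) =
      joinStacks (fun _ => []) (update (fun _ => []) i w) := by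
  rw [← update_joinStacks]
  congr 1
  funext k
  rcases k with k | v <;> rfl

theorem outputsInTime_toFinTM2 {F : Prog tm V} {i o : V} {w w' : List Γ'} {t : ℕ}
    (h : F.Exec (update (fun _ => []) i w) (update (fun _ => []) o w') t) :
    Nonempty (TM2OutputsInTime (F.toFinTM2 i o) (w.map (Equiv.refl Γ'))
      (some (w'.map (Equiv.refl Γ'))) (t + 1)) := by
  have hid : ∀ l : List Γ', l = l.map (Equiv.refl Γ') := fun l => (List.map_id l).symm
  suffices H : Nonempty (TM2OutputsInTime (F.toFinTM2 i o) w (some w') (t + 1)) by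
    refine hid w ▸ hid w' ▸ H
  obtain ⟨v', t', ht', h⟩ := h _ some none (F.toFinTM2 i o).m (fun _ => rfl)
    (F.toFinTM2 i o).initialState
  refine ⟨⟨⟨t' + 1, ?_⟩, Nat.succ_le_succ ht'⟩⟩
  have h1 : initList (F.toFinTM2 i o) w = ⟨some (some F.entry), (F.toFinTM2 i o).initialState,
      joinStacks (fun _ => []) (update (fun _ => []) i w)⟩ :=
    (initList_eq (F.toFinTM2 i o) w).trans
      (congrArg (TM2.Cfg.mk (some (some F.entry)) (F.toFinTM2 i o).initialState)
        (update_inr_eq_joinStacks i w))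
  have h2 : haltList (F.toFinTM2 i o) w' = ⟨none, (F.toFinTM2 i o).initialState,
      joinStacks (fun _ => []) (update (fun _ => []) o w')⟩ :=
    (haltList_eq (F.toFinTM2 i o) w').trans
      (congrArg (TM2.Cfg.mk none (F.toFinTM2 i o).initialState)
        (update_inr_eq_joinStacks o w'))
  rw [h1, add_comm, iterate_add_apply]
  refine (congrArg _ h).trans ?_
  exact (congrArg some h2).symm

end Prog

/-- A search problem is solvable in polynomial time if some program takes the word of each valid
instance to the word of a solution, within a polynomial number of steps. -/
theorem polyTimeSolvable_of_exec {α β : Type} {ea : α → List Γ'} {eb : β → List Γ'}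
    {valid : α → Prop} {sol : α → β → Prop} (F : Prog tm V) (i o : V) (p : Polynomial ℕ)
    (h : ∀ a, valid a → ∃ b, sol a b ∧
      F.Exec (update (fun _ => []) i (ea a)) (update (fun _ => []) o (eb b))
        (p.eval (ea a).length)) :
    PolyTimeSolvable ea eb valid sol := by
  choose f hsol hexec using fun a : {a // valid a} => h a.1 a.2
  refine ⟨f, ⟨⟨⟨F.toFinTM2 i o, Equiv.refl _, Equiv.refl _⟩, p + 1, fun a => ?_⟩⟩, hsol⟩
  have := Classical.choice (Prog.outputsInTime_toFinTM2 (hexec a))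
  rw [Polynomial.eval_add, Polynomial.eval_one]
  exact this

end Solvable

/-! ### Moving words between registers -/

namespace Prog

section Move

variable {tm : FinTM2} {V : Type} [DecidableEq V] [Fintype V]

omit [Fintype V] in
theorem Exec.congr {F : Prog tm V} {s s₁ s₂ : V → List Γ'} {t t' : ℕ} (h : F.Exec s s₁ t)
    (hs : s₁ = s₂) (ht : t ≤ t') : F.Exec s s₂ t' :=
  hs ▸ h.mono ht

theorem exec_step_of_eq {a : (V → Option Γ') → V → StackAction} {s s' : V → List Γ'}
    (h : ∀ v, (a (tops s) v).apply (s v) = s' v) : (step tm a).Exec s s' 1 :=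
  (exec_step a s).congr (funext h) le_rfl

/-- As long as the top symbol of `src` satisfies `p`, move it to all registers in `dst`. The moved
word arrives in reverse order. -/
noncomputable def moveWhile (tm : FinTM2) (p : Γ' → Bool) (src : V) (dst : List V) : Prog tm V :=
  loop (fun τ => (τ src).any p)
    (step tm fun τ v => if v = src then .pop else if v ∈ dst then
      .push ((τ src).getD Γ'.blank) else .keep)

theorem exec_moveWhile {p : Γ' → Bool} {src : V} {dst : List V} (hd : src ∉ dst)
    {l rest : List Γ'} (hl : ∀ a ∈ l, p a = true) (hr : rest.head?.any p = false)
    {s : V → List Γ'} (hs : s src = l ++ rest) :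
    (moveWhile tm p src dst).Exec s
      (fun v => if v = src then rest else if v ∈ dst then l.reverse ++ s v else s v)
      (2 * l.length + 1) := by
  induction l generalizing s with
  | nil =>
    refine Exec.congr (Exec.loop_false ?_) ?_ le_rfl
    · simpa [tops, hs] using hr
    · funext v
      by_cases h : v = src
      · subst h; simpa using hs
      · simp [h]
  | cons a l ih =>
    refine Exec.congr (Exec.loop_true ?_ (exec_step _ s) (ih (fun b hb => hl b (by simp [hb])) ?_))
      ?_ ?_
    · simpa [tops, hs] using hl a (by simp)
    · simp [hs]
    · funext v
      by_cases h : v = src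
      · simp [h]
      · by_cases h' : v ∈ dst
        · simp [h, h', tops, hs]
        · simp [h, h']
    · simp; omega

/-- Move the contents of `src` to all registers in `dst`, in reverse order. -/
noncomputable def move (tm : FinTM2) (src : V) (dst : List V) : Prog tm V :=
  moveWhile tm (fun _ => true) src dst

theorem exec_move (s : V → List Γ') {src : V} {dst : List V} (hd : src ∉ dst) :
    (move tm src dst).Exec s
      (fun v => if v = src then [] else if v ∈ dst then (s src).reverse ++ s v else s v)
      (2 * (s src).length + 1) :=
  exec_moveWhile hd (by simp) rfl (by simp)

/-- Run the machine `tm` on the word in register `i`, and put its output into register `o`. -/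
noncomputable def call (e₀ : tm.Γ tm.k₀ ≃ Γ') (e₁ : tm.Γ tm.k₁ ≃ Γ') (i tmp o : V) :
    Prog tm V :=
  (move tm i [tmp]).seq <| (feed e₀ tmp).seq <| (runMachine tm V).seq <|
    (fetch e₁ tmp).seq (move tm tmp [o])

theorem exec_call {e₀ : tm.Γ tm.k₀ ≃ Γ'} {e₁ : tm.Γ tm.k₁ ≃ Γ'} {i tmp o : V}
    (hi : i ≠ tmp) (ho : o ≠ tmp) {w w' : List Γ'} {t : ℕ}
    (h : TM2OutputsInTime tm (w.map e₀.symm) (some (w'.map e₁.symm)) t) {s : V → List Γ'}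
    (hw : s i = w) (htmp : s tmp = []) (hso : update s i [] o = []) :
    (call e₀ e₁ i tmp o).Exec s (update (update s i []) o w')
      (t + 3 * w.length + 3 * w'.length + 5) := by
  have h1 := (exec_move (tm := tm) s (src := i) (dst := [tmp]) (by simpa using hi)).congr
    (s₂ := update (update s i []) tmp w.reverse) (by
      funext v
      by_cases h : v = i
      · subst h; simp [hi]
      · by_cases h' : v = tmp
        · subst h'; simp [h, hw, htmp]
        · simp [h, h']) le_rfl
  have h2 := runs_feed (tm := tm) e₀ tmp w.reverse (update s i []) []
  have h3 := runs_runMachine (V := V) h (update (update s i []) tmp [])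
  have h4 := runs_fetch e₁ tmp [] (update s i []) (w'.map e₁.symm)
  have h5 := (exec_move (tm := tm) (update (update s i []) tmp w'.reverse) (src := tmp)
    (dst := [o]) (by simpa using ho.symm)).congr (s₂ := update (update s i []) o w') (by
      funext v
      by_cases h : v = tmp
      · subst h; simp [ho.symm, hi.symm, htmp]
      · by_cases h' : v = o
        · subst h'; simp [h, hso]
        · simp [h, h']) le_rfl
  simp only [List.map_reverse, List.reverse_reverse, List.append_nil,
    List.map_map, Equiv.self_comp_symm, List.map_id, List.length_reverse, List.length_map,
    update_self] at h2 h4 h5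
  have h0 : (update (fun _ => []) tm.k₀ [] : ∀ k, List (tm.Γ k)) = fun _ => [] := by simp
  rw [h0] at h2
  refine Exec.mono (Runs.seq h1 (Runs.seq h2 (Runs.seq h3 (Runs.seq h4 h5)))) ?_
  rw [hw]
  omega

end Move

end Prog

/-! ### Binary words of natural numbers -/

/-- The word of a number in binary, least significant bit first. -/
def numWord (n : ℕ) : List Γ' := (encodeNat n).map Γ'.bit

/-- The number with binary digits `l`, most significant bit first, appended to those of `a`. -/
def ofBits (l : List Bool) (a : ℕ) : ℕ := l.foldl (fun a b => 2 * a + b.toNat) a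

/-- The bit on top of a stack, `false` if there is none. -/
def bitOf : Option Γ' → Bool
  | some (.bit b) => b
  | _ => false

/-- Push a bit on a stack with a number, but no leading zero. -/
def pushBit : Option Γ' → Bool → StackAction
  | none, false => .keep
  | _, b => .push (.bit b)

@[simp] theorem bitOf_none : bitOf none = false := rfl

@[simp] theorem bitOf_some_bit (b : Bool) : bitOf (some (.bit b)) = b := rfl

@[simp] theorem ofBits_nil (a : ℕ) : ofBits [] a = a := rfl

@[simp] theorem ofBits_cons (b : Bool) (l : List Bool) (a : ℕ) :
    ofBits (b :: l) a = ofBits l (2 * a + b.toNat) := rfl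

@[simp] theorem ofBits_append_singleton (b : Bool) (l : List Bool) (a : ℕ) :
    ofBits (l ++ [b]) a = 2 * ofBits l a + b.toNat := by
  simp [ofBits]

@[simp] theorem numWord_zero : numWord 0 = [] := rfl

theorem encodeNat_bit (b : Bool) (n : ℕ) (h : n ≠ 0 ∨ b = true) :
    encodeNat (2 * n + b.toNat) = b :: encodeNat n := by
  have h0 : ((n : ℕ) : Num) = 0 → n = 0 := fun h => by
    have := congrArg (fun m : Num => (m : ℕ)) h
    simpa using this
  unfold encodeNat
  cases b with
  | false =>
    have : ((2 * n + false.toNat : ℕ) : Num) = Num.bit0 n := by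
      rw [← Num.bit0_of_bit0]; simp [two_mul]
    rw [this]
    rcases hn : ((n : ℕ) : Num) with _ | p
    · exact absurd (h0 hn) (by simpa using h)
    · rfl
  | true =>
    have : ((2 * n + true.toNat : ℕ) : Num) = Num.bit1 n := by
      rw [← Num.bit1_of_bit1]; simp [two_mul]
    rw [this]
    rcases hn : ((n : ℕ) : Num) with _ | p <;> rfl

theorem numWord_bit (b : Bool) (n : ℕ) (h : n ≠ 0 ∨ b = true) :
    numWord (2 * n + b.toNat) = .bit b :: numWord n := by
  simp [numWord, encodeNat_bit b n h]

theorem numWord_of_ne_zero {n : ℕ} (h : n ≠ 0) :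
    numWord n = .bit (decide (n % 2 = 1)) :: numWord (n / 2) := by
  rw [← numWord_bit _ _ (by by_cases h' : n % 2 = 1 <;> simp [h']; omega)]
  congr 1
  by_cases h' : n % 2 = 1 <;> simp [h'] <;> omega

@[simp] theorem numWord_one : numWord 1 = [.bit true] := numWord_of_ne_zero one_ne_zero

@[simp] theorem numWord_eq_nil {n : ℕ} : numWord n = [] ↔ n = 0 := by
  by_cases h : n = 0
  · simp [h]
  · simp [numWord_of_ne_zero h, h]

@[simp] theorem tail_numWord (n : ℕ) : (numWord n).tail = numWord (n / 2) := by
  by_cases h : n = 0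
  · simp [h]
  · simp [numWord_of_ne_zero h]

@[simp] theorem bitOf_head?_numWord (n : ℕ) : bitOf (numWord n).head? = decide (n % 2 = 1) := by
  by_cases h : n = 0
  · simp [h]
  · simp [numWord_of_ne_zero h]

@[simp] theorem apply_pushBit_numWord (n : ℕ) (b : Bool) :
    (pushBit (numWord n).head? b).apply (numWord n) = numWord (2 * n + b.toNat) := by
  by_cases h : n = 0
  · subst h
    cases b <;> rfl
  · rw [numWord_bit _ _ (.inl h)]
    conv_rhs => rw [numWord_of_ne_zero h]
    conv_lhs => rw [numWord_of_ne_zero h]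
    cases b <;> rfl

theorem length_numWord_le {n k : ℕ} (h : n < 2 ^ k) : (numWord n).length ≤ k := by
  induction k generalizing n with
  | zero => simp [show n = 0 by simpa using h]
  | succ k ih =>
    by_cases h0 : n = 0
    · simp [h0]
    · rw [numWord_of_ne_zero h0]
      simpa using ih (by rw [pow_succ] at h; omega)

theorem lt_two_pow_length_numWord (n : ℕ) : n < 2 ^ (numWord n).length := by
  induction n using Nat.strong_induction_on with
  | _ n ih =>
    by_cases h0 : n = 0
    · simp [h0]
    · have := ih (n / 2) (by omega)
      rw [numWord_of_ne_zero h0, List.length_cons, pow_succ]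
      omega

theorem exists_reverse_numWord (n : ℕ) :
    ∃ l : List Bool, (numWord n).reverse = l.map Γ'.bit ∧ ofBits l 0 = n := by
  induction n using Nat.strong_induction_on with
  | _ n ih =>
    by_cases h0 : n = 0
    · exact ⟨[], by simp [h0]⟩
    · obtain ⟨l, hl, h⟩ := ih (n / 2) (by omega)
      refine ⟨l ++ [decide (n % 2 = 1)], ?_, ?_⟩
      · rw [numWord_of_ne_zero h0]; simp [hl]
      · rw [ofBits_append_singleton, h]
        by_cases h' : n % 2 = 1 <;> simp [h'] <;> omega

/-! ### Registers and binary arithmetic -/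

/-- The registers of the factorization programs. Those from `x` on are scratch registers of the
arithmetical operations, which are empty between these operations. -/
inductive Reg
  | input | output | query | answer | num | fac | cof | rem | tmp | u₁ | u₂ | u₃ | rest | flag
  | x | y | z | q | carry | lx | ly | lz | lo
  deriving DecidableEq

instance : Fintype Reg where
  elems := {.input, .output, .query, .answer, .num, .fac, .cof, .rem, .tmp, .u₁, .u₂, .u₃, .rest,
    .flag, .x, .y, .z, .q, .carry, .lx, .ly, .lz, .lo}
  complete v := by cases v <;> decide

/-- The scratch registers. -/
def Reg.isScratch : Reg → Bool
  | .x | .y | .z | .q | .carry | .lx | .ly | .lz | .lo => true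
  | _ => false

theorem Reg.ne_scratch {r : Reg} (hr : r.isScratch = false) :
    (r ≠ .x ∧ r ≠ .y ∧ r ≠ .z ∧ r ≠ .q ∧ r ≠ .carry ∧ r ≠ .lx ∧ r ≠ .ly ∧ r ≠ .lz ∧ r ≠ .lo) ∧
      .x ≠ r ∧ .y ≠ r ∧ .z ≠ r ∧ .q ≠ r ∧ .carry ≠ r ∧ .lx ≠ r ∧ .ly ≠ r ∧ .lz ≠ r ∧ .lo ≠ r := by
  cases r <;> simp_all [isScratch]

namespace Prog

variable {tm : FinTM2}

/-- Digitwise addition of `z` and `y`. The digits of the sum are collected in `lz`, those of `y`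
in `ly`, with the most significant one on top. A carry is a digit `1` in the register `carry`, which
is empty otherwise. -/
noncomputable def addDigits (tm : FinTM2) : Prog tm Reg :=
  loop (fun τ => (τ .z).isSome || (τ .y).isSome || (τ .carry).isSome) (step tm fun τ v =>
    match v with
    | .z => .pop
    | .y => .pop
    | .lz => .push (.bit ((bitOf (τ .z) ^^ bitOf (τ .y)) ^^ bitOf (τ .carry)))
    | .ly => .push (.bit (bitOf (τ .y)))
    | .carry =>
      if (bitOf (τ .z) && bitOf (τ .y)) || ((bitOf (τ .z) || bitOf (τ .y)) && bitOf (τ .carry))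
      then if bitOf (τ .carry) then .keep else .push (.bit true)
      else .pop
    | _ => .keep)

/-- Move the digits in `lz` and `ly` back to `z` and `y`. -/
noncomputable def restoreSum (tm : FinTM2) : Prog tm Reg :=
  loop (fun τ => (τ .lz).isSome) (step tm fun τ v =>
    match v with
    | .lz => .pop
    | .ly => .pop
    | .z => pushBit (τ .z) (bitOf (τ .lz))
    | .y => pushBit (τ .y) (bitOf (τ .ly))
    | _ => .keep)

/-- Digitwise subtraction of `y` from `z`. The digits of the difference are collected in `lz`, those
of `z` and `y` in `lo` and `ly`, with the most significant one on top. The register `carry` holds the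
borrow. -/
noncomputable def subDigits (tm : FinTM2) : Prog tm Reg :=
  loop (fun τ => (τ .z).isSome || (τ .y).isSome) (step tm fun τ v =>
    match v with
    | .z => .pop
    | .y => .pop
    | .lz => .push (.bit ((bitOf (τ .z) ^^ bitOf (τ .y)) ^^ bitOf (τ .carry)))
    | .ly => .push (.bit (bitOf (τ .y)))
    | .lo => .push (.bit (bitOf (τ .z)))
    | .carry =>
      if (!bitOf (τ .z) && (bitOf (τ .y) || bitOf (τ .carry))) ||
        (bitOf (τ .y) && bitOf (τ .carry))
      then if bitOf (τ .carry) then .keep else .push (.bit true)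
      else .pop
    | _ => .keep)

/-- Move the digits in `ly` back to `y`, and to `z` those of the difference if there is no borrow
left, and the old ones of `z` otherwise. -/
noncomputable def restoreDiff (tm : FinTM2) : Prog tm Reg :=
  loop (fun τ => (τ .ly).isSome) (step tm fun τ v =>
    match v with
    | .lz => .pop
    | .ly => .pop
    | .lo => .pop
    | .z => pushBit (τ .z) (if bitOf (τ .carry) then bitOf (τ .lo) else bitOf (τ .lz))
    | .y => pushBit (τ .y) (bitOf (τ .ly))
    | _ => .keep)

theorem numWord_toNat (c : Bool) : numWord c.toNat = if c then [.bit true] else [] := by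
  cases c
  · rfl
  · exact numWord_of_ne_zero (n := 1) (by simp)

theorem exec_addDigits (k a b : ℕ) (c : Bool) (hk : a + b + c.toNat < 2 ^ k) (s : Reg → List Γ')
    (hz : s .z = numWord a) (hy : s .y = numWord b) (hc : s .carry = numWord c.toNat) :
    ∃ dz dy : List Bool, dz.length = dy.length ∧ dz.length ≤ k ∧ ofBits dz 0 = a + b + c.toNat ∧
      ofBits dy 0 = b ∧ (addDigits tm).Exec s (fun v => match v with
        | .z => [] | .y => [] | .carry => []
        | .lz => dz.map .bit ++ s .lz
        | .ly => dy.map .bit ++ s .ly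
        | v => s v) (2 * k + 1) := by
  induction k generalizing a b c s with
  | zero =>
    have ha : a = 0 := by omega
    have hb : b = 0 := by omega
    have hc' : c = false := by cases c <;> simp at hk ⊢
    subst ha hb hc'
    refine ⟨[], [], rfl, le_rfl, rfl, rfl, (Exec.loop_false ?_).congr ?_ le_rfl⟩
    · simp [tops, hz, hy, hc]
    · funext v; cases v <;> simp [hz, hy, hc]
  | succ k ih =>
    by_cases h0 : a + b + c.toNat = 0
    · have ha : a = 0 := by omega
      have hb : b = 0 := by omega
      have hc' : c = false := by cases c <;> simp at h0 ⊢
      subst ha hb hc'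
      refine ⟨[], [], rfl, by simp, rfl, rfl, (Exec.loop_false ?_).congr ?_ (by omega)⟩
      · simp [tops, hz, hy, hc]
      · funext v; cases v <;> simp [hz, hy, hc]
    · obtain ⟨az, hza⟩ : ∃ az : Bool, decide (a % 2 = 1) = az := ⟨_, rfl⟩
      obtain ⟨bz, hzb⟩ : ∃ bz : Bool, decide (b % 2 = 1) = bz := ⟨_, rfl⟩
      have ha2 : a = 2 * (a / 2) + az.toNat := by
        by_cases h' : a % 2 = 1 <;> simp [← hza, h'] <;> omega
      have hb2 : b = 2 * (b / 2) + bz.toNat := by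
        by_cases h' : b % 2 = 1 <;> simp [← hzb, h'] <;> omega
      have hcar : bitOf (numWord c.toNat).head? = c := by cases c <;> simp
      set c' : Bool := (az && bz) || ((az || bz) && c) with hc'
      set d : Bool := (az ^^ bz) ^^ c with hd
      have hsum : az.toNat + bz.toNat + c.toNat = 2 * c'.toNat + d.toNat := by
        rw [hc', hd]; cases az <;> cases bz <;> cases c <;> rfl
      obtain ⟨s₁, hs₁⟩ : ∃ s₁ : Reg → List Γ', s₁ = fun v => match v with
          | .z => numWord (a / 2) | .y => numWord (b / 2) | .carry => numWord c'.toNat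
          | .lz => .bit d :: s .lz
          | .ly => .bit bz :: s .ly
          | v => s v := ⟨_, rfl⟩
      obtain ⟨dz, dy, hlen, hle, hvz, hvy, hex⟩ := ih (a / 2) (b / 2) c'
        (by rw [pow_succ] at hk; omega) s₁ (by rw [hs₁]) (by rw [hs₁]) (by rw [hs₁])
      refine ⟨dz ++ [d], dy ++ [bz], by simp [hlen], by simpa using hle, ?_, ?_,
        (Exec.loop_true ?_ (exec_step_of_eq ?_) hex).congr ?_ (by omega)⟩
      · rw [ofBits_append_singleton, hvz]; omega
      · rw [ofBits_append_singleton, hvy]; omega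
      · simp only [tops, hz, hy, hc]
        by_contra hcon
        cases c <;> simp at h0 hcon
        omega
      · intro v
        rw [hs₁]
        cases v <;> simp only [StackAction.apply_keep, StackAction.apply_pop,
          StackAction.apply_push, tops, hz, hy, hc, tail_numWord,
          bitOf_head?_numWord, hza, hzb, hcar, ← hd]
        rw [← hc', numWord_toNat, numWord_toNat]
        cases c <;> cases c' <;> rfl
      · funext v; cases v <;> simp [hs₁]

theorem exec_restoreSum (dz dy : List Bool) (hlen : dz.length = dy.length) (a b : ℕ)
    (s : Reg → List Γ') (hz : s .z = numWord a) (hy : s .y = numWord b)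
    (hlz : s .lz = dz.map .bit) (hly : s .ly = dy.map .bit) :
    (restoreSum tm).Exec s (fun v => match v with
      | .z => numWord (ofBits dz a) | .y => numWord (ofBits dy b)
      | .lz => [] | .ly => []
      | v => s v) (2 * dz.length + 1) := by
  induction dz generalizing dy a b s with
  | nil =>
    obtain rfl : dy = [] := by simpa using hlen.symm
    refine (Exec.loop_false ?_).congr ?_ le_rfl
    · simp [tops, hlz]
    · funext v; cases v <;> simp [hz, hy, hlz, hly]
  | cons d dz ih =>
    obtain ⟨e, dy, rfl⟩ : ∃ e l, dy = e :: l := by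
      cases dy
      · simp at hlen
      · exact ⟨_, _, rfl⟩
    refine (Exec.loop_true ?_ (exec_step_of_eq (s' := fun v => match v with
          | .z => numWord (2 * a + d.toNat) | .y => numWord (2 * b + e.toNat)
          | .lz => dz.map .bit | .ly => dy.map .bit
          | v => s v) ?_)
        (ih dy (by simpa using hlen) (2 * a + d.toNat) (2 * b + e.toNat) _ rfl rfl rfl rfl)).congr
        ?_ ?_
    · simp [tops, hlz]
    · intro v
      cases v <;> simp [tops, hlz, hly, hz, hy]
    · funext v; cases v <;> simp
    · simp; omega

theorem exec_subDigits (k a b : ℕ) (c : Bool) (ha : a < 2 ^ k) (hb : b < 2 ^ k)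
    (s : Reg → List Γ')
    (hz : s .z = numWord a) (hy : s .y = numWord b) (hc : s .carry = numWord c.toNat) :
    ∃ dz dy dold : List Bool, dz.length = dy.length ∧ dold.length = dy.length ∧ dy.length ≤ k ∧
      (b + c.toNat ≤ a → ofBits dz 0 = a - b - c.toNat) ∧ ofBits dold 0 = a ∧ ofBits dy 0 = b ∧
      (subDigits tm).Exec s (fun v => match v with
        | .z => [] | .y => []
        | .carry => if b + c.toNat ≤ a then [] else [.bit true]
        | .lz => dz.map .bit ++ s .lz
        | .ly => dy.map .bit ++ s .ly
        | .lo => dold.map .bit ++ s .lo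
        | v => s v) (2 * k + 1) := by
  induction k generalizing a b c s with
  | zero =>
    obtain rfl : a = 0 := by simpa using ha
    obtain rfl : b = 0 := by simpa using hb
    refine ⟨[], [], [], rfl, rfl, le_rfl, by simp, rfl, rfl, (Exec.loop_false ?_).congr ?_ le_rfl⟩
    · simp [tops, hz, hy]
    · funext v; cases v <;> cases c <;> simp [hz, hy, hc]
  | succ k ih =>
    by_cases h0 : a + b = 0
    · obtain rfl : a = 0 := by omega
      obtain rfl : b = 0 := by omega
      refine ⟨[], [], [], rfl, rfl, by simp, by simp, rfl, rfl,
        (Exec.loop_false ?_).congr ?_ (by omega)⟩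
      · simp [tops, hz, hy]
      · funext v; cases v <;> cases c <;> simp [hz, hy, hc]
    · obtain ⟨az, hza⟩ : ∃ az : Bool, decide (a % 2 = 1) = az := ⟨_, rfl⟩
      obtain ⟨bz, hzb⟩ : ∃ bz : Bool, decide (b % 2 = 1) = bz := ⟨_, rfl⟩
      have ha2 : a = 2 * (a / 2) + az.toNat := by
        by_cases h' : a % 2 = 1 <;> simp [← hza, h'] <;> omega
      have hb2 : b = 2 * (b / 2) + bz.toNat := by
        by_cases h' : b % 2 = 1 <;> simp [← hzb, h'] <;> omega
      have hcar : bitOf (numWord c.toNat).head? = c := by cases c <;> simp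
      set c' : Bool := (!az && (bz || c)) || (bz && c) with hc'
      set d : Bool := (az ^^ bz) ^^ c with hd
      have hsum : az.toNat + 2 * c'.toNat = d.toNat + bz.toNat + c.toNat := by
        rw [hc', hd]; cases az <;> cases bz <;> cases c <;> rfl
      have hle1 := Bool.toNat_le az
      have hle2 := Bool.toNat_le d
      have hcmp : b / 2 + c'.toNat ≤ a / 2 ↔ b + c.toNat ≤ a := by omega
      obtain ⟨s₁, hs₁⟩ : ∃ s₁ : Reg → List Γ', s₁ = fun v => match v with
          | .z => numWord (a / 2) | .y => numWord (b / 2) | .carry => numWord c'.toNat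
          | .lz => .bit d :: s .lz
          | .ly => .bit bz :: s .ly
          | .lo => .bit az :: s .lo
          | v => s v := ⟨_, rfl⟩
      obtain ⟨dz, dy, dold, hl1, hl2, hle, hvz, hvo, hvy, hex⟩ := ih (a / 2) (b / 2) c'
        (by rw [pow_succ] at ha; omega) (by rw [pow_succ] at hb; omega) s₁ (by rw [hs₁])
        (by rw [hs₁]) (by rw [hs₁])
      refine ⟨dz ++ [d], dy ++ [bz], dold ++ [az], by simp [hl1], by simp [hl2], by simpa using hle,
        ?_, ?_, ?_, (Exec.loop_true ?_ (exec_step_of_eq ?_) hex).congr ?_ (by omega)⟩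
      · intro h
        rw [ofBits_append_singleton, hvz (hcmp.2 h)]; omega
      · rw [ofBits_append_singleton, hvo]; omega
      · rw [ofBits_append_singleton, hvy]; omega
      · simp only [tops, hz, hy]
        by_contra hcon
        simp at hcon
        omega
      · intro v
        rw [hs₁]
        cases v <;> simp only [StackAction.apply_keep, StackAction.apply_pop,
          StackAction.apply_push, tops, hz, hy, hc, tail_numWord,
          bitOf_head?_numWord, hza, hzb, hcar, ← hd]
        rw [← hc', numWord_toNat, numWord_toNat]
        cases c <;> cases c' <;> rfl
      · funext v; cases v <;> simp [hs₁, hcmp]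

theorem exec_restoreDiff (dz dy dold : List Bool) (h1 : dz.length = dy.length)
    (h2 : dold.length = dy.length) (a b : ℕ)
    (s : Reg → List Γ') (hz : s .z = numWord a) (hy : s .y = numWord b)
    (hlz : s .lz = dz.map .bit) (hly : s .ly = dy.map .bit) (hlo : s .lo = dold.map .bit) :
    (restoreDiff tm).Exec s (fun v => match v with
      | .z => numWord (if bitOf (tops s .carry) then ofBits dold a else ofBits dz a)
      | .y => numWord (ofBits dy b)
      | .lz => [] | .ly => [] | .lo => []
      | v => s v) (2 * dy.length + 1) := by
  induction dy generalizing dz dold a b s with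
  | nil =>
    obtain rfl : dz = [] := by simpa using h1
    obtain rfl : dold = [] := by simpa using h2
    refine (Exec.loop_false ?_).congr ?_ le_rfl
    · simp [tops, hly]
    · funext v; cases v <;> simp [hz, hy, hlz, hly, hlo]
  | cons e dy ih =>
    obtain ⟨d, dz, rfl⟩ : ∃ e l, dz = e :: l := by
      cases dz
      · simp at h1
      · exact ⟨_, _, rfl⟩
    obtain ⟨f, dold, rfl⟩ : ∃ e l, dold = e :: l := by
      cases dold
      · simp at h2
      · exact ⟨_, _, rfl⟩
    refine (Exec.loop_true ?_ (exec_step_of_eq (s' := fun v => match v with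
          | .z => numWord (2 * a + (if bitOf (tops s .carry) then f else d).toNat)
          | .y => numWord (2 * b + e.toNat)
          | .lz => dz.map .bit | .ly => dy.map .bit | .lo => dold.map .bit
          | v => s v) ?_)
        (ih dz dold (by simpa using h1) (by simpa using h2) _ _ _ rfl rfl rfl rfl rfl)).congr
        ?_ ?_
    · simp [tops, hly]
    · intro v
      cases v <;> simp [tops, hlz, hly, hlo, hz, hy]
      congr
    · funext v
      cases v <;> simp [tops]
      by_cases h : bitOf (s .carry).head? = true <;> simp [h]
    · simp; omega

/-- Add `y` to `z`. -/
noncomputable def addUnit (tm : FinTM2) : Prog tm Reg := (addDigits tm).seq (restoreSum tm)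

/-- Subtract `y` from `z` if it is not larger than `z`, and otherwise set `carry`. -/
noncomputable def subUnit (tm : FinTM2) : Prog tm Reg := (subDigits tm).seq (restoreDiff tm)

theorem exec_addUnit {k a b : ℕ} (hk : a + b < 2 ^ k) {s : Reg → List Γ'}
    (hz : s .z = numWord a) (hy : s .y = numWord b) (hc : s .carry = []) (hlz : s .lz = [])
    (hly : s .ly = []) :
    (addUnit tm).Exec s (update s .z (numWord (a + b))) (4 * k + 2) := by
  obtain ⟨dz, dy, hlen, hle, hvz, hvy, hex⟩ := exec_addDigits (tm := tm) k a b false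
    (by simpa using hk) s hz hy hc
  refine (Exec.seq hex (exec_restoreSum dz dy hlen 0 0 _ rfl rfl ?_ ?_)).congr ?_ (by omega)
  · simp [hlz]
  · simp [hly]
  · funext v; cases v <;> simp [hvz, hvy, hy, hc, hlz, hly]

theorem exec_subUnit {k a b : ℕ} (ha : a < 2 ^ k) (hb : b < 2 ^ k) {s : Reg → List Γ'}
    (hz : s .z = numWord a) (hy : s .y = numWord b) (hc : s .carry = []) (hlz : s .lz = [])
    (hly : s .ly = []) (hlo : s .lo = []) :
    (subUnit tm).Exec s (update (update s .z (numWord (if b ≤ a then a - b else a))) .carry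
      (if b ≤ a then [] else [.bit true])) (4 * k + 2) := by
  obtain ⟨dz, dy, dold, h1, h2, hle, hvz, hvo, hvy, hex⟩ := exec_subDigits (tm := tm) k a b false
    ha hb s hz hy hc
  refine (Exec.seq hex (exec_restoreDiff dz dy dold h1 h2 0 0 _ rfl rfl ?_ ?_ ?_)).congr ?_
    (by omega)
  · simp [hlz]
  · simp [hly]
  · simp [hlo]
  · simp only [Bool.toNat_false, add_zero, Nat.sub_zero] at hvz
    by_cases h : b ≤ a
    · funext v; cases v <;> simp [hvz, hvy, hy, hlz, hly, hlo, h, tops]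
    · funext v; cases v <;> simp [hvy, hvo, hy, hlz, hly, hlo, h, tops]

end Prog

/-! ### Multiplication and division -/

namespace Prog

variable {tm : FinTM2}

theorem le_ofBits (l : List Bool) (a : ℕ) : a ≤ ofBits l a := by
  induction l generalizing a with
  | nil => exact le_rfl
  | cons b l ih => exact le_trans (by omega) (ih (2 * a + b.toNat))

/-- Take the next binary digit of the multiplier from `lx` back to `x`, and double `z`. -/
noncomputable def shiftProduct (tm : FinTM2) : Prog tm Reg := step tm fun τ v =>
  match v with
  | .lx => .pop
  | .x => pushBit (τ .x) (bitOf (τ .lx))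
  | .z => pushBit (τ .z) false
  | _ => .keep

/-- Put the product of `x` and `y` into `z`, by Horner's rule for the binary digits of `x`. -/
noncomputable def mulUnit (tm : FinTM2) : Prog tm Reg :=
  (move tm .x [.lx]).seq <| loop (fun τ => (τ .lx).isSome) <|
    ite (fun τ => bitOf (τ .lx)) ((shiftProduct tm).seq (addUnit tm)) (shiftProduct tm)

theorem exec_mulUnit {k a b : ℕ} (hk : a * b < 2 ^ k) {s : Reg → List Γ'}
    (hx : s .x = numWord a) (hy : s .y = numWord b) (hz : s .z = []) (hc : s .carry = [])
    (hlx : s .lx = []) (hlz : s .lz = []) (hly : s .ly = []) :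
    (mulUnit tm).Exec s (update s .z (numWord (a * b)))
      (2 * (numWord a).length + 1 + (numWord a).length * (4 * k + 5) + 1) := by
  have main : ∀ (l : List Bool) (a : ℕ) (s : Reg → List Γ'), ofBits l a * b < 2 ^ k →
      s .x = numWord a → s .y = numWord b → s .z = numWord (a * b) → s .lx = l.map .bit →
      s .carry = [] → s .lz = [] → s .ly = [] →
      (loop (fun τ => (τ .lx).isSome) <| ite (fun τ => bitOf (τ .lx))
        ((shiftProduct tm).seq (addUnit tm)) (shiftProduct tm)).Exec s
        (update (update (update s .x (numWord (ofBits l a))) .z (numWord (ofBits l a * b))) .lx [])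
        (l.length * (4 * k + 5) + 1) := by
    intro l
    induction l with
    | nil =>
      intro a s _ hx hy hz hlx hc hlz hly
      refine (Exec.loop_false ?_).congr ?_ (by simp)
      · simp [tops, hlx]
      · funext v; cases v <;> simp [hx, hz, hlx]
    | cons d l ih =>
      intro a s hk hx hy hz hlx hc hlz hly
      obtain ⟨s₁, hs₁⟩ : ∃ s₁, s₁ = update (update (update s .x (numWord (2 * a + d.toNat)))
        .z (numWord (2 * (a * b)))) .lx (l.map .bit) := ⟨_, rfl⟩
      have h1 : (shiftProduct tm).Exec s s₁ 1 := by
        refine exec_step_of_eq fun v => ?_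
        have := apply_pushBit_numWord (a * b) false
        rw [hs₁]
        cases v <;> simp_all [tops]
      have hle : (2 * a + d.toNat) * b < 2 ^ k :=
        lt_of_le_of_lt (Nat.mul_le_mul_right _ (le_ofBits l _)) hk
      obtain ⟨s₂, hs₂⟩ : ∃ s₂, s₂ = update s₁ .z (numWord ((2 * a + d.toNat) * b)) := ⟨_, rfl⟩
      have h2 := ih (2 * a + d.toNat) s₂ hk (by simp [hs₁, hs₂]) (by simp [hs₁, hs₂, hy])
        (by simp [hs₂]) (by simp [hs₁, hs₂]) (by simp [hs₁, hs₂, hc]) (by simp [hs₁, hs₂, hlz])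
        (by simp [hs₁, hs₂, hly])
      refine (Exec.loop_true (s₁ := s₂) (t₁ := 4 * k + 4) ?_ ?_ h2).congr ?_ ?_
      · simp [tops, hlx]
      · cases d
        · refine (Exec.ite_false ?_ h1).congr ?_ (by omega)
          · simp [tops, hlx]
          · rw [hs₂, hs₁]
            funext v; cases v <;> simp [mul_assoc]
        · refine (Exec.ite_true ?_ (h1.seq (exec_addUnit (k := k) (a := 2 * (a * b)) (b := b) ?_
            ?_ ?_ ?_ ?_ ?_))).congr ?_ (by omega)
          · simp [tops, hlx]
          · refine lt_of_eq_of_lt ?_ hle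
            simp; ring
          · simp [hs₁]
          · simp [hs₁, hy]
          · simp [hs₁, hc]
          · simp [hs₁, hlz]
          · simp [hs₁, hly]
          · rw [hs₂]
            congr 2
            simp; ring
      · rw [hs₂, hs₁]
        funext v; cases v <;> simp
      · simp; ring_nf; omega
  obtain ⟨l, hl, hval⟩ := exists_reverse_numWord a
  have hlen : l.length = (numWord a).length := by
    simpa using (congrArg List.length hl).symm
  rw [← hlen]
  refine (Exec.seq (exec_move s (by simp)) (main l 0 _ (by rwa [hval]) ?_ ?_ ?_ ?_ ?_ ?_ ?_)).congr
    ?_ ?_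
  · simp
  · simp [hy]
  · simp [hz]
  · simp [hx, hl, hlx]
  · simp [hc]
  · simp [hlz]
  · simp [hly]
  · funext v; cases v <;> simp [hval, hx, hlx]
  · rw [hx, hlen]; omega

/-- Take the next binary digit of the dividend from `lx` back to `x`, and append it to the
remainder `z`. -/
noncomputable def shiftRemainder (tm : FinTM2) : Prog tm Reg := step tm fun τ v =>
  match v with
  | .lx => .pop
  | .x => pushBit (τ .x) (bitOf (τ .lx))
  | .z => pushBit (τ .z) (bitOf (τ .lx))
  | _ => .keep

/-- Append a binary digit to the quotient `q`, which is `0` if the subtraction has failed. -/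
noncomputable def appendQuotient (tm : FinTM2) : Prog tm Reg := step tm fun τ v =>
  match v with
  | .q => pushBit (τ .q) (τ .carry).isNone
  | .carry => .pop
  | _ => .keep

/-- Divide `x` by `y`, with quotient `q` and remainder `z`, by long division. -/
noncomputable def divUnit (tm : FinTM2) : Prog tm Reg :=
  (move tm .x [.lx]).seq <| loop (fun τ => (τ .lx).isSome) <|
    (shiftRemainder tm).seq ((subUnit tm).seq (appendQuotient tm))

theorem exec_divUnit {k a b : ℕ} (ha : a < 2 ^ k) (hb : b < 2 ^ k) (hb0 : 0 < b)
    {s : Reg → List Γ'} (hx : s .x = numWord a) (hy : s .y = numWord b) (hz : s .z = [])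
    (hq : s .q = []) (hc : s .carry = []) (hlx : s .lx = []) (hlz : s .lz = [])
    (hly : s .ly = []) (hlo : s .lo = []) :
    (divUnit tm).Exec s (update (update s .q (numWord (a / b))) .z (numWord (a % b)))
      (2 * (numWord a).length + 1 + (numWord a).length * (4 * k + 5) + 1) := by
  have main : ∀ (l : List Bool) (a : ℕ) (s : Reg → List Γ'), ofBits l a < 2 ^ k →
      s .x = numWord a → s .y = numWord b → s .q = numWord (a / b) → s .z = numWord (a % b) →
      s .lx = l.map .bit → s .carry = [] → s .lz = [] → s .ly = [] → s .lo = [] →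
      (loop (fun τ => (τ .lx).isSome) <|
        (shiftRemainder tm).seq ((subUnit tm).seq (appendQuotient tm))).Exec s
        (update (update (update (update s .x (numWord (ofBits l a))) .q (numWord (ofBits l a / b)))
          .z (numWord (ofBits l a % b))) .lx [])
        (l.length * (4 * k + 5) + 1) := by
    intro l
    induction l with
    | nil =>
      intro a s _ hx hy hq hz hlx hc hlz hly hlo
      refine (Exec.loop_false ?_).congr ?_ (by simp)
      · simp [tops, hlx]
      · funext v; cases v <;> simp [hx, hz, hlx, hq]
    | cons d l ih =>
      intro a s hk hx hy hq hz hlx hc hlz hly hlo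
      obtain ⟨s₁, hs₁⟩ : ∃ s₁, s₁ = update (update (update s .x (numWord (2 * a + d.toNat)))
        .z (numWord (2 * (a % b) + d.toNat))) .lx (l.map .bit) := ⟨_, rfl⟩
      have h1 : (shiftRemainder tm).Exec s s₁ 1 := by
        refine exec_step_of_eq fun v => ?_
        rw [hs₁]
        cases v <;> simp [tops, hx, hz, hlx]
      have hle : 2 * a + d.toNat < 2 ^ k := lt_of_le_of_lt (le_ofBits l _) hk
      have hmod : a % b ≤ a := Nat.mod_le _ _
      have hd1 := Bool.toNat_le d
      have hlt := Nat.mod_lt a hb0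
      -- one step of long division
      have hdm := Nat.div_add_mod a b
      have hsplit : (2 * a + d.toNat) = b * (2 * (a / b)) + (2 * (a % b) + d.toNat) := by
        nlinarith
      have hdiv : (2 * a + d.toNat) / b =
          2 * (a / b) + (decide (b ≤ 2 * (a % b) + d.toNat)).toNat := by
        rw [hsplit, Nat.mul_add_div hb0]
        congr 1
        by_cases h : b ≤ 2 * (a % b) + d.toNat
        · simp only [h, decide_true, Bool.toNat_true]
          rw [Nat.div_eq_iff hb0]; omega
        · simp only [h, decide_false, Bool.toNat_false]
          exact Nat.div_eq_of_lt (by omega)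
      have hmod2 : (2 * a + d.toNat) % b = if b ≤ 2 * (a % b) + d.toNat then
          2 * (a % b) + d.toNat - b else 2 * (a % b) + d.toNat := by
        rw [hsplit, Nat.mul_add_mod]
        split_ifs with h
        · rw [Nat.mod_eq_sub_mod h, Nat.mod_eq_of_lt (by omega)]
        · exact Nat.mod_eq_of_lt (by omega)
      have h2 := exec_subUnit (tm := tm) (k := k) (a := 2 * (a % b) + d.toNat) (b := b) (s := s₁)
        (by omega) hb (by simp [hs₁]) (by simp [hs₁, hy]) (by simp [hs₁, hc]) (by simp [hs₁, hlz])
        (by simp [hs₁, hly]) (by simp [hs₁, hlo])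
      rw [← hmod2] at h2
      obtain ⟨s₂, hs₂⟩ : ∃ s₂, s₂ = update (update s₁ .z (numWord ((2 * a + d.toNat) % b))) .q
        (numWord ((2 * a + d.toNat) / b)) := ⟨_, rfl⟩
      have h3 : (appendQuotient tm).Exec (update (update s₁ .z (numWord ((2 * a + d.toNat) % b)))
          .carry (if b ≤ 2 * (a % b) + d.toNat then [] else [.bit true])) s₂ 1 := by
        refine exec_step_of_eq fun v => ?_
        rw [hs₂, hs₁, hdiv]
        by_cases h : b ≤ 2 * (a % b) + d.toNat
        · cases v <;> simp [tops, h, hc]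
          simp [hq]
        · cases v <;> simp [tops, h, hc]
          simp [hq]
      have h4 := ih (2 * a + d.toNat) s₂ hk (by simp [hs₁, hs₂]) (by simp [hs₁, hs₂, hy])
        (by simp [hs₂]) (by simp [hs₂]) (by simp [hs₁, hs₂]) (by simp [hs₁, hs₂, hc])
        (by simp [hs₁, hs₂, hlz]) (by simp [hs₁, hs₂, hly]) (by simp [hs₁, hs₂, hlo])
      refine (Exec.loop_true ?_ (h1.seq (h2.seq h3)) h4).congr ?_ ?_
      · simp [tops, hlx]
      · rw [hs₂, hs₁]
        funext v; cases v <;> simp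
      · simp; ring_nf; omega
  obtain ⟨l, hl, hval⟩ := exists_reverse_numWord a
  have hlen : l.length = (numWord a).length := by
    simpa using (congrArg List.length hl).symm
  rw [← hlen]
  refine (Exec.seq (exec_move s (by simp)) (main l 0 _ (by rwa [hval]) ?_ ?_ ?_ ?_ ?_ ?_ ?_ ?_
    ?_)).congr ?_ ?_
  · simp
  · simp [hy]
  · simp [hq]
  · simp [hz]
  · simp [hx, hl, hlx]
  · simp [hc]
  · simp [hlz]
  · simp [hly]
  · simp [hlo]
  · funext v; cases v <;> simp [hval, hx, hlx]
  · rw [hx, hlen]; omega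

/-! ### Operations on arbitrary registers -/

/-- All scratch registers are empty. -/
def Clean (s : Reg → List Γ') : Prop := ∀ v, v.isScratch = true → s v = []

theorem Clean.update {s : Reg → List Γ'} (h : Clean s) {r : Reg} (hr : r.isScratch = false)
    (w : List Γ') : Clean (update s r w) := by
  intro v hv
  rw [update_of_ne (by rintro rfl; simp [hr] at hv)]
  exact h v hv

/-- Empty a register. -/
noncomputable def clear (tm : FinTM2) (r : Reg) : Prog tm Reg := move tm r []

theorem exec_clear (r : Reg) (s : Reg → List Γ') :
    (clear tm r).Exec s (update s r []) (2 * (s r).length + 1) := by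
  refine (exec_move s (by simp)).congr ?_ le_rfl
  funext v
  by_cases h : v = r
  · subst h; simp
  · simp [h]

/-- Copy a register to an empty one. -/
noncomputable def copy (tm : FinTM2) (r d : Reg) : Prog tm Reg :=
  (move tm r [.lx]).seq (move tm .lx [r, d])

theorem exec_copy {r d : Reg} {s : Reg → List Γ'} (hrd : r ≠ d) (hr : r ≠ .lx) (hd : d ≠ .lx)
    (hlx : s .lx = []) (hsd : s d = []) :
    (copy tm r d).Exec s (update s d (s r)) (4 * (s r).length + 2) := by
  refine (Exec.seq (exec_move s (by simpa using hr)) (exec_move _ (by simp [hr.symm, hd.symm]))).congr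
    ?_ ?_
  · funext v
    by_cases h1 : v = .lx
    · subst h1; simp [hlx, hd.symm]
    · by_cases h2 : v = r
      · subst h2; simp [hr, hrd, hr.symm, hlx]
      · by_cases h3 : v = d
        · subst h3; simp [hd, h2, hr.symm, hlx, hsd]
        · simp [h1, h2, h3]
  · simp [hr.symm, hlx]; omega

/-- Push a symbol. -/
noncomputable def pushSym (tm : FinTM2) (r : Reg) (a : Γ') : Prog tm Reg :=
  step tm fun _ v => if v = r then .push a else .keep

theorem exec_pushSym (r : Reg) (a : Γ') (s : Reg → List Γ') :
    (pushSym tm r a).Exec s (update s r (a :: s r)) 1 := by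
  refine exec_step_of_eq fun v => ?_
  by_cases h : v = r
  · subst h; simp
  · simp [h]

/-- Pop a symbol. -/
noncomputable def popSym (tm : FinTM2) (r : Reg) : Prog tm Reg :=
  step tm fun _ v => if v = r then .pop else .keep

theorem exec_popSym (r : Reg) (s : Reg → List Γ') :
    (popSym tm r).Exec s (update s r (s r).tail) 1 := by
  refine exec_step_of_eq fun v => ?_
  by_cases h : v = r
  · subst h; simp
  · simp [h]

/-- Put the word in register `r` and a comma in front of the word in register `w`. -/
noncomputable def emit (tm : FinTM2) (r w : Reg) : Prog tm Reg :=
  (pushSym tm w .comma).seq ((move tm r [.lx]).seq (move tm .lx [r, w]))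

theorem exec_emit {r w : Reg} {s : Reg → List Γ'} (hrw : r ≠ w) (hr : r ≠ .lx) (hw : w ≠ .lx)
    (hlx : s .lx = []) :
    (emit tm r w).Exec s (update s w (s r ++ .comma :: s w)) (4 * (s r).length + 3) := by
  refine (Exec.seq (exec_pushSym w .comma s) (Exec.seq (exec_move _ (by simpa using hr))
    (exec_move _ (by simp [hr.symm, hw.symm])))).congr ?_ ?_
  · funext v
    by_cases h1 : v = .lx
    · subst h1; simp [hlx, hw.symm]
    · by_cases h2 : v = r
      · subst h2; simp [hr, hrw, hr.symm, hlx, hw.symm]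
      · by_cases h3 : v = w
        · subst h3; simp [hw, h2, hr.symm, hlx, hw.symm, hrw]
        · simp [h1, h2, h3]
  · simp [hr.symm, hlx, hrw, hw.symm]; omega

/-- The symbol is a bit. -/
def isBit : Γ' → Bool
  | .bit _ => true
  | _ => false

/-- Move the first number of the word in register `w` to the empty register `r`. -/
noncomputable def parse (tm : FinTM2) (w r : Reg) : Prog tm Reg :=
  (moveWhile tm isBit w [.lx]).seq ((popSym tm w).seq (move tm .lx [r]))

theorem exec_parse {w r : Reg} {s : Reg → List Γ'} {n : ℕ} {l : List Γ'} (hrw : r ≠ w)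
    (hr : r ≠ .lx) (hw : w ≠ .lx) (hlx : s .lx = []) (hsr : s r = [])
    (hs : s w = numWord n ++ .comma :: l) :
    (parse tm w r).Exec s (update (update s w l) r (numWord n))
      (4 * (numWord n).length + 3) := by
  refine (Exec.seq (exec_moveWhile (l := numWord n) (rest := .comma :: l) (by simpa using hw) ?_
    (by simp [isBit]) hs) (Exec.seq (exec_popSym w _) (exec_move _ (by simpa using hr.symm)))).congr
    ?_ ?_
  · intro a ha
    obtain ⟨b, -, rfl⟩ := List.mem_map.1 ha
    rfl
  · funext v
    by_cases h1 : v = .lx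
    · subst h1; simp [hlx, hr.symm, hw.symm]
    · by_cases h2 : v = r
      · subst h2; simp [hr, hrw, hlx, hw.symm, hsr]
      · by_cases h3 : v = w
        · subst h3; simp [hw, h2]
        · simp [h1, h2, h3]
  · simp [hlx, hw.symm]; omega

/-- A bound for the number of steps of the arithmetical operations on numbers below `2 ^ k`. -/
def arithTime (k : ℕ) : ℕ := 100 * (k + 1) ^ 2

/-- `d := a * b` -/
noncomputable def mul (tm : FinTM2) (a b d : Reg) : Prog tm Reg :=
  (copy tm a .x).seq <| (copy tm b .y).seq <| (mulUnit tm).seq <| (copy tm .z d).seq <|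
    (clear tm .x).seq <| (clear tm .y).seq (clear tm .z)

/-- `d := a + b` -/
noncomputable def add (tm : FinTM2) (a b d : Reg) : Prog tm Reg :=
  (copy tm a .z).seq <| (copy tm b .y).seq <| (addUnit tm).seq <| (copy tm .z d).seq <|
    (clear tm .y).seq (clear tm .z)

/-- `d := a - b` if `b ≤ a`, and otherwise `d := a` -/
noncomputable def sub (tm : FinTM2) (a b d : Reg) : Prog tm Reg :=
  (copy tm a .z).seq <| (copy tm b .y).seq <| (subUnit tm).seq <| (copy tm .z d).seq <|
    (clear tm .carry).seq <| (clear tm .y).seq (clear tm .z)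

/-- `d := a / b` and `e := a % b` -/
noncomputable def divMod (tm : FinTM2) (a b d e : Reg) : Prog tm Reg :=
  (copy tm a .x).seq <| (copy tm b .y).seq <| (divUnit tm).seq <| (copy tm .q d).seq <|
    (copy tm .z e).seq <| (clear tm .x).seq <| (clear tm .y).seq <| (clear tm .q).seq (clear tm .z)

theorem Clean.eq_nil {s : Reg → List Γ'} (h : Clean s) :
    s .x = [] ∧ s .y = [] ∧ s .z = [] ∧ s .q = [] ∧ s .carry = [] ∧ s .lx = [] ∧ s .ly = [] ∧
      s .lz = [] ∧ s .lo = [] :=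
  ⟨h _ rfl, h _ rfl, h _ rfl, h _ rfl, h _ rfl, h _ rfl, h _ rfl, h _ rfl, h _ rfl⟩

section

variable {a b d e : Reg} (ha : a.isScratch = false) (hb : b.isScratch = false)
  (hd : d.isScratch = false) (he : e.isScratch = false) {s : Reg → List Γ'} (hs : Clean s)
  {k m n : ℕ} (hm : m < 2 ^ k) (hn : n < 2 ^ k) (hsa : s a = numWord m) (hsb : s b = numWord n)
  (hsd : s d = [])

include ha hb hd hs hm hn hsa hsb hsd

theorem exec_mul : (mul tm a b d).Exec s (update s d (numWord (m * n))) (arithTime k) := by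
  have hmn : m * n < 2 ^ (2 * k) := by
    rw [two_mul, pow_add]; exact Nat.mul_lt_mul'' hm hn
  have l1 := length_numWord_le hm
  have l2 := length_numWord_le hn
  have l3 := length_numWord_le hmn
  have na := Reg.ne_scratch ha
  have nb := Reg.ne_scratch hb
  have nd := Reg.ne_scratch hd
  have hs := hs.eq_nil
  refine (Exec.seq (exec_copy (d := .x) (by simp [na]) (by simp [na]) (by simp) (by simp [hs])
      (by simp [hs])) <|
    Exec.seq (exec_copy (d := .y) (by simp [nb]) (by simp [nb]) (by simp) (by simp [hs])
      (by simp [hs])) <|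
    Exec.seq (exec_mulUnit hmn (by simp [hsa]) (by simp [hsb, nb]) (by simp [hs])
      (by simp [hs]) (by simp [hs]) (by simp [hs]) (by simp [hs])) <|
    Exec.seq (exec_copy (r := .z) (by simp [nd]) (by simp) (by simp [nd]) (by simp [hs])
      (by simp [nd, hsd])) <|
    Exec.seq (exec_clear _ _) <| Exec.seq (exec_clear _ _) (exec_clear _ _)).congr ?_ ?_
  · funext v
    by_cases h : v = d
    · subst h; simp [nd]
    · cases v <;> simp [h, hs]
  · simp [nb, nd, hsa, hsb, arithTime]
    nlinarith

theorem exec_add : (add tm a b d).Exec s (update s d (numWord (m + n))) (arithTime k) := by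
  have hmn : m + n < 2 ^ (k + 1) := by rw [pow_succ]; omega
  have l1 := length_numWord_le hm
  have l2 := length_numWord_le hn
  have l3 := length_numWord_le hmn
  have na := Reg.ne_scratch ha
  have nb := Reg.ne_scratch hb
  have nd := Reg.ne_scratch hd
  have hs := hs.eq_nil
  refine (Exec.seq (exec_copy (d := .z) (by simp [na]) (by simp [na]) (by simp) (by simp [hs])
      (by simp [hs])) <|
    Exec.seq (exec_copy (d := .y) (by simp [nb]) (by simp [nb]) (by simp) (by simp [hs])
      (by simp [hs])) <|
    Exec.seq (exec_addUnit hmn (by simp [hsa]) (by simp [hsb, nb]) (by simp [hs])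
      (by simp [hs]) (by simp [hs])) <|
    Exec.seq (exec_copy (r := .z) (by simp [nd]) (by simp) (by simp [nd]) (by simp [hs])
      (by simp [nd, hsd])) <|
    Exec.seq (exec_clear _ _) (exec_clear _ _)).congr ?_ ?_
  · funext v
    by_cases h : v = d
    · subst h; simp [nd]
    · cases v <;> simp [h, hs]
  · simp [nb, nd, hsa, hsb, arithTime]
    nlinarith

theorem exec_sub : (sub tm a b d).Exec s
    (update s d (numWord (if n ≤ m then m - n else m))) (arithTime k) := by
  have l1 := length_numWord_le hm
  have l2 := length_numWord_le hn
  have l3 : (numWord (if n ≤ m then m - n else m)).length ≤ k :=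
    length_numWord_le (by split_ifs <;> omega)
  have na := Reg.ne_scratch ha
  have nb := Reg.ne_scratch hb
  have nd := Reg.ne_scratch hd
  have hs := hs.eq_nil
  refine (Exec.seq (exec_copy (d := .z) (by simp [na]) (by simp [na]) (by simp) (by simp [hs])
      (by simp [hs])) <|
    Exec.seq (exec_copy (d := .y) (by simp [nb]) (by simp [nb]) (by simp) (by simp [hs])
      (by simp [hs])) <|
    Exec.seq (exec_subUnit hm hn (by simp [hsa]) (by simp [hsb, nb]) (by simp [hs])
      (by simp [hs]) (by simp [hs]) (by simp [hs])) <|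
    Exec.seq (exec_copy (r := .z) (by simp [nd]) (by simp) (by simp [nd]) (by simp [hs])
      (by simp [nd, hsd])) <|
    Exec.seq (exec_clear _ _) <| Exec.seq (exec_clear _ _) (exec_clear _ _)).congr ?_ ?_
  · funext v
    by_cases h : v = d
    · subst h; simp [nd]
    · cases v <;> simp [h, hs]
  · have l4 : (if n ≤ m then [] else [Γ'.bit true]).length ≤ 1 := by split_ifs <;> simp
    simp [nb, nd, hsa, hsb, arithTime]
    nlinarith

include he

theorem exec_divMod (hn0 : 0 < n) (hde : d ≠ e) (hse : s e = []) :
    (divMod tm a b d e).Exec s (update (update s d (numWord (m / n))) e (numWord (m % n)))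
      (arithTime k) := by
  have l1 := length_numWord_le hm
  have l2 := length_numWord_le hn
  have l3 := length_numWord_le ((Nat.div_le_self m n).trans_lt hm)
  have l4 := length_numWord_le ((Nat.mod_le m n).trans_lt hm)
  have na := Reg.ne_scratch ha
  have nb := Reg.ne_scratch hb
  have nd := Reg.ne_scratch hd
  have ne := Reg.ne_scratch he
  have hs := hs.eq_nil
  refine (Exec.seq (exec_copy (d := .x) (by simp [na]) (by simp [na]) (by simp) (by simp [hs])
      (by simp [hs])) <|
    Exec.seq (exec_copy (d := .y) (by simp [nb]) (by simp [nb]) (by simp) (by simp [hs])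
      (by simp [hs])) <|
    Exec.seq (exec_divUnit hm hn hn0 (by simp [hsa]) (by simp [hsb, nb]) (by simp [hs])
      (by simp [hs]) (by simp [hs]) (by simp [hs]) (by simp [hs]) (by simp [hs]) (by simp [hs])) <|
    Exec.seq (exec_copy (r := .q) (by simp [nd]) (by simp) (by simp [nd]) (by simp [hs])
      (by simp [nd, hsd])) <|
    Exec.seq (exec_copy (r := .z) (by simp [ne]) (by simp) (by simp [ne]) (by simp [hs, nd])
      (by simp [ne, hde.symm, hse])) <|
    Exec.seq (exec_clear _ _) <| Exec.seq (exec_clear _ _) <| Exec.seq (exec_clear _ _)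
      (exec_clear _ _)).congr ?_ ?_
  · funext v
    by_cases h : v = e
    · subst h; simp [ne, nd]
    · by_cases h' : v = d
      · subst h'; simp [h, nd]
      · cases v <;> simp [h, h', hs]
  · simp [nb, nd, ne, hsa, hsb, arithTime]
    nlinarith

end

end Prog

/-! ### Optimal solutions of the two instances -/

namespace TwoItemJRP

/-- If the cost is at least `q₁ + q₂`, only finitely many pairs compete with `(1, 1)`. -/
theorem exists_isOptimal {cost : ℕ → ℕ → ℚ}
    (h : ∀ q₁ q₂ : ℕ, 0 < q₁ → 0 < q₂ → (q₁ + q₂ : ℚ) ≤ cost q₁ q₂) :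
    ∃ q₁ q₂, IsOptimal cost q₁ q₂ := by
  obtain ⟨B, hB⟩ := exists_nat_ge (cost 1 1)
  have h11 := h 1 1 one_pos one_pos
  have hB1 : 1 ≤ B := by
    have : (1 : ℚ) ≤ B := by push_cast at h11; linarith
    exact_mod_cast this
  obtain ⟨⟨q₁, q₂⟩, hq, hmin⟩ := Finset.exists_min_image (Finset.Icc 1 B ×ˢ Finset.Icc 1 B)
    (fun q => cost q.1 q.2) ⟨(1, 1), by simp [hB1]⟩
  simp only [Finset.mem_product, Finset.mem_Icc] at hq
  refine ⟨q₁, q₂, by omega, by omega, fun r₁ r₂ h₁ h₂ => ?_⟩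
  by_cases hr : r₁ ≤ B ∧ r₂ ≤ B
  · exact hmin (r₁, r₂) (by simp only [Finset.mem_product, Finset.mem_Icc]; omega)
  · refine (hmin (1, 1) (by simp [hB1])).trans (hB.trans ?_)
    have h3 : (B : ℚ) ≤ r₁ + r₂ := by
      have : B ≤ r₁ + r₂ := by omega
      exact_mod_cast this
    exact h3.trans (h r₁ r₂ h₁ h₂)

theorem add_le_aperiodicCost {I : TwoItemJRP} (hI : I.IsAperiodicInstance) {q₁ q₂ : ℕ}
    (h₁ : 0 < q₁) (h₂ : 0 < q₂) : (q₁ + q₂ : ℚ) ≤ I.aperiodicCost q₁ q₂ := by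
  obtain ⟨hH₁, hH₂, hK₁, -⟩ := hI
  have hq₁ : (0 : ℚ) < q₁ := by exact_mod_cast h₁
  have hq₂ : (0 : ℚ) < q₂ := by exact_mod_cast h₂
  have e1 : (I.K₀ : ℚ) / (Nat.lcm q₁ q₂ : ℕ) ≤ I.K₁ / q₁ := by
    have : q₁ ≤ Nat.lcm q₁ q₂ := Nat.le_of_dvd (Nat.lcm_pos h₁ h₂) (Nat.dvd_lcm_left _ _)
    gcongr
  have e2 : (1 : ℚ) ≤ I.H₁ := by exact_mod_cast hH₁
  have e3 : (1 : ℚ) ≤ I.H₂ := by exact_mod_cast hH₂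
  have e4 : (0 : ℚ) ≤ I.K₂ / q₂ := by positivity
  unfold aperiodicCost eoq
  nlinarith

theorem add_le_periodicCost {I : TwoItemJRP} (hI : I.IsPeriodicInstance) {q₁ q₂ : ℕ} :
    (q₁ + q₂ : ℚ) ≤ I.periodicCost q₁ q₂ := by
  obtain ⟨hH₁, hH₂, -⟩ := hI
  have e2 : (1 : ℚ) ≤ I.H₁ := by exact_mod_cast hH₁
  have e3 : (1 : ℚ) ≤ I.H₂ := by exact_mod_cast hH₂
  have e4 : (0 : ℚ) ≤ I.K₂ / q₂ := by positivity
  have e5 : (0 : ℚ) ≤ I.K₁ / q₁ := by positivity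
  have e6 : (0 : ℚ) ≤ I.K₀ / (Nat.gcd q₁ q₂ : ℕ) := by positivity
  have e7 : (0 : ℚ) ≤ q₁ := by positivity
  have e8 : (0 : ℚ) ≤ q₂ := by positivity
  unfold periodicCost eoq
  nlinarith

/-- The periods of an optimal solution of the aperiodic problem are bounded by the coefficients. -/
theorem IsOptimal.add_le_of_aperiodic {I : TwoItemJRP} (hI : I.IsAperiodicInstance) {q₁ q₂ : ℕ}
    (h : IsOptimal I.aperiodicCost q₁ q₂) : q₁ + q₂ ≤ I.coeffs.sum := by
  have h1 := add_le_aperiodicCost hI h.1 h.2.1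
  have h2 := h.2.2 1 1 one_pos one_pos
  have h3 : I.aperiodicCost 1 1 ≤ (I.coeffs.sum : ℕ) := by
    simp [aperiodicCost, eoq, coeffs]
    have : (0 : ℚ) ≤ I.K₀ := by positivity
    linarith
  exact_mod_cast h1.trans (h2.trans h3)

/-- The periods of an optimal solution of the periodic problem are bounded by the coefficients. -/
theorem IsOptimal.add_le_of_periodic {I : TwoItemJRP} (hI : I.IsPeriodicInstance) {q₁ q₂ : ℕ}
    (h : IsOptimal I.periodicCost q₁ q₂) : q₁ + q₂ ≤ I.coeffs.sum := by
  have h1 := add_le_periodicCost hI (q₁ := q₁) (q₂ := q₂)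
  have h2 := h.2.2 1 1 one_pos one_pos
  have h3 : I.periodicCost 1 1 ≤ (I.coeffs.sum : ℕ) := by
    simp [periodicCost, eoq, coeffs]
    linarith
  exact_mod_cast h1.trans (h2.trans h3)

theorem isAperiodicInstance_aperiodicInstance {M : ℕ} (hM : 2 ≤ M) :
    (aperiodicInstance M).IsAperiodicInstance := by
  have h1 : 0 < M ^ 2 - 1 := by have : 2 ^ 2 ≤ M ^ 2 := Nat.pow_le_pow_left hM 2; omega
  refine ⟨by simp [aperiodicInstance], Nat.mul_pos (by omega) h1, le_rfl, ?_⟩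
  refine Nat.mul_le_mul ?_ ?_
  · exact Nat.le_self_pow (by norm_num) M
  · exact Nat.sub_le_sub_right (Nat.le_self_pow (by norm_num) M) 1

theorem isPeriodicInstance_periodicInstance {M : ℕ} (hM : 0 < M) :
    (periodicInstance M).IsPeriodicInstance :=
  ⟨by simp [periodicInstance], Nat.mul_pos hM (by omega), hM⟩

theorem coeffs_aperiodicInstance_le {M : ℕ} (hM : 2 ≤ M) :
    ∀ c ∈ (aperiodicInstance M).coeffs, c ≤ M ^ 5 := by
  have h1 : M * (M - 1) ≤ M ^ 5 := calc
    M * (M - 1) ≤ M * M := Nat.mul_le_mul_left _ (Nat.sub_le _ _)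
    _ = M ^ 2 := by ring
    _ ≤ M ^ 5 := Nat.pow_le_pow_right (by omega) (by norm_num)
  have h2 : 4 ≤ M ^ 5 := le_trans (by norm_num) (Nat.pow_le_pow_left hM 5)
  have h3 : M ^ 3 * (M ^ 2 - 1) ≤ M ^ 5 := calc
    M ^ 3 * (M ^ 2 - 1) ≤ M ^ 3 * M ^ 2 := Nat.mul_le_mul_left _ (Nat.sub_le _ _)
    _ = M ^ 5 := by ring
  have h4 : M * (M ^ 2 - 1) ≤ M ^ 5 := calc
    M * (M ^ 2 - 1) ≤ M * M ^ 2 := Nat.mul_le_mul_left _ (Nat.sub_le _ _)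
    _ = M ^ 3 := by ring
    _ ≤ M ^ 5 := Nat.pow_le_pow_right (by omega) (by norm_num)
  simp [coeffs, aperiodicInstance, h1, h2, h3, h4]

theorem coeffs_periodicInstance_le {M : ℕ} (hM : 2 ≤ M) :
    ∀ c ∈ (periodicInstance M).coeffs, c ≤ M ^ 5 := by
  have h1 : M ≤ M ^ 5 := Nat.le_self_pow (by norm_num) M
  have h2 : 1 ≤ M ^ 5 := Nat.one_le_pow _ _ (by omega)
  have h3 : M ^ 3 * (M + 1) ≤ M ^ 5 := calc
    M ^ 3 * (M + 1) ≤ M ^ 3 * M ^ 2 := Nat.mul_le_mul_left _ (by nlinarith)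
    _ = M ^ 5 := by ring
  have h4 : M * (M + 1) ≤ M ^ 5 := calc
    M * (M + 1) ≤ M * M ^ 2 := Nat.mul_le_mul_left _ (by nlinarith)
    _ = M ^ 3 := by ring
    _ ≤ M ^ 5 := Nat.pow_le_pow_right (by omega) (by norm_num)
  simp [coeffs, periodicInstance, h1, h2, h3, h4]

theorem sizeBound_of_le_pow {I : TwoItemJRP} {M : ℕ} (hM : 2 ≤ M)
    (h : ∀ c ∈ I.coeffs, c ≤ M ^ 5) : I.SizeBound M := by
  intro c hc
  have hpow : Real.logb 2 ((M : ℝ) ^ 5) = 5 * Real.logb 2 M := by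
    rw [Real.logb_pow]; norm_num
  rcases Nat.eq_zero_or_pos c with rfl | h0
  · have : 0 ≤ Real.logb 2 (M : ℝ) :=
      Real.logb_nonneg (by norm_num) (by exact_mod_cast (by omega : 1 ≤ M))
    simpa using this
  · rw [← hpow]
    exact Real.logb_le_logb_of_le (by norm_num) (by exact_mod_cast h0) (by exact_mod_cast h c hc)

/-- The objective of the aperiodic instance, without truncated subtraction. -/
theorem aperiodicCost_aperiodicInstance {M : ℕ} (hM : 2 ≤ M) (q₁ q₂ : ℕ) :
    (aperiodicInstance M).aperiodicCost q₁ q₂ =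
      (M : ℚ) * (M - 1) / q₁ + 4 * q₁ + ((M : ℚ) ^ 3 * (M ^ 2 - 1) / q₂ + M * (M ^ 2 - 1) * q₂) -
        M * (M - 1) / (Nat.lcm q₁ q₂ : ℕ) := by
  have h1 : 1 ≤ M ^ 2 := Nat.one_le_pow _ _ (by omega)
  have h2 : 1 ≤ M := by omega
  simp [aperiodicCost, eoq, aperiodicInstance, Nat.cast_sub h1, Nat.cast_sub h2]

/-- With `q₂ = M`, the discount turns the fixed cost of the first item into `(M - 1) * (M - g)`,
where `g` is the common divisor of `q₁` and `M`. -/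
theorem aperiodicCost_aperiodicInstance_self {M : ℕ} (hM : 2 ≤ M) {q₁ : ℕ} (h₁ : 0 < q₁) :
    (aperiodicInstance M).aperiodicCost q₁ M =
      ((M : ℚ) - 1) * (M - (Nat.gcd q₁ M : ℕ)) / q₁ + 4 * q₁ + 2 * M ^ 2 * (M ^ 2 - 1) := by
  have hM0 : (M : ℚ) ≠ 0 := by exact_mod_cast (by omega : M ≠ 0)
  have hq : (q₁ : ℚ) ≠ 0 := by exact_mod_cast h₁.ne'
  have hg : ((Nat.gcd q₁ M : ℕ) : ℚ) * (Nat.lcm q₁ M : ℕ) = q₁ * M := by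
    exact_mod_cast Nat.gcd_mul_lcm q₁ M
  have hl : ((Nat.lcm q₁ M : ℕ) : ℚ) ≠ 0 := by
    exact_mod_cast (Nat.lcm_pos h₁ (by omega)).ne'
  have hdisc : (M : ℚ) * (M - 1) / (Nat.lcm q₁ M : ℕ) = (M - 1) * (Nat.gcd q₁ M : ℕ) / q₁ := by
    rw [div_eq_div_iff hl hq]
    linear_combination -((M : ℚ) - 1) * hg
  rw [aperiodicCost_aperiodicInstance hM, hdisc]
  field_simp
  ring

/-- By integrality, a period other than `M` has a quadratic deviation that is not too small compared
with the period. -/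
theorem le_mul_sq_sub {M q : ℕ} (hne : q ≠ M) : (q : ℚ) ≤ (M + 1) * (q - M) ^ 2 := by
  have hk : ((q : ℤ) - M) ≠ 0 := sub_ne_zero.2 (by exact_mod_cast hne)
  have hk1 : (1 : ℤ) ≤ ((q : ℤ) - M) ^ 2 := Int.one_le_abs hk |> fun h => by
    rw [← sq_abs]; nlinarith
  have hk2 : ((q : ℤ) - M) ≤ ((q : ℤ) - M) ^ 2 := by nlinarith [Int.le_self_sq ((q : ℤ) - M)]
  have : (q : ℤ) ≤ (M + 1) * ((q : ℤ) - M) ^ 2 := by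
    have : (M : ℤ) ≤ M * ((q : ℤ) - M) ^ 2 := by
      have h0 : (0 : ℤ) ≤ M := by positivity
      nlinarith
    nlinarith
  exact_mod_cast this

/-- A second period other than `M` costs at least `M * (M - 1)` more than `M`: its own cost exceeds
the minimum by `M * (M ^ 2 - 1) * (q₂ - M) ^ 2 / q₂`. -/
theorem le_aperiodicCost_of_ne {M : ℕ} (hM : 2 ≤ M) {q₁ q₂ : ℕ} (h₁ : 0 < q₁) (h₂ : 0 < q₂)
    (hne : q₂ ≠ M) :
    4 + 2 * (M : ℚ) ^ 2 * (M ^ 2 - 1) + M * (M - 1) ≤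
      (aperiodicInstance M).aperiodicCost q₁ q₂ := by
  have hM2 : (2 : ℚ) ≤ M := by exact_mod_cast hM
  have hq₁ : (1 : ℚ) ≤ q₁ := by exact_mod_cast h₁
  have hq₂ : (0 : ℚ) < q₂ := by exact_mod_cast h₂
  have e1 : (M : ℚ) * (M - 1) / (Nat.lcm q₁ q₂ : ℕ) ≤ M * (M - 1) / q₁ := by
    have h0 : q₁ ≤ Nat.lcm q₁ q₂ := Nat.le_of_dvd (Nat.lcm_pos h₁ h₂) (Nat.dvd_lcm_left _ _)
    have h0' : (q₁ : ℚ) ≤ (Nat.lcm q₁ q₂ : ℕ) := by exact_mod_cast h0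
    have h00 : (0 : ℚ) ≤ M * (M - 1) := by nlinarith
    exact div_le_div_of_nonneg_left h00 (by linarith) h0'
  have e2 := le_mul_sq_sub hne
  have e3 : (M : ℚ) ^ 3 * (M ^ 2 - 1) / q₂ + M * (M ^ 2 - 1) * q₂ =
      2 * M ^ 2 * (M ^ 2 - 1) + M * (M - 1) * ((M + 1) * (q₂ - M) ^ 2 / q₂) := by
    field_simp
    ring
  have e4 : 1 ≤ ((M : ℚ) + 1) * (q₂ - M) ^ 2 / q₂ := by rwa [le_div_iff₀ hq₂, one_mul]
  have e5 : (M : ℚ) * (M - 1) ≤ M * (M - 1) * ((M + 1) * (q₂ - M) ^ 2 / q₂) :=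
    le_mul_of_one_le_right (by nlinarith) e4
  rw [aperiodicCost_aperiodicInstance hM, e3]
  linarith

/-- For each proper divisor `g` of `M`, the first period `(M - g) / 2` is a good one. -/
theorem exists_aperiodicCost_le {M g : ℕ} (hM : Odd M) (hM2 : 2 ≤ M) (hg : g ∣ M) (hgM : g < M) :
    ∃ q₁, 0 < q₁ ∧ (aperiodicInstance M).aperiodicCost q₁ M ≤
      2 * (M - 1) + 2 * (M - g) + 2 * (M : ℚ) ^ 2 * (M ^ 2 - 1) := by
  obtain ⟨h, rfl⟩ := hg
  obtain ⟨hg1, l, rfl⟩ := Nat.odd_mul.1 hM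
  have hg0 : 0 < g := hg1.pos
  have hl : 0 < l := by
    rcases Nat.eq_zero_or_pos l with rfl | h
    · simp at hgM
    · exact h
  refine ⟨g * l, Nat.mul_pos hg0 hl, ?_⟩
  rw [aperiodicCost_aperiodicInstance_self hM2 (Nat.mul_pos hg0 hl)]
  have hle : g ≤ Nat.gcd (g * l) (g * (2 * l + 1)) :=
    Nat.le_of_dvd (Nat.gcd_pos_of_pos_left _ (Nat.mul_pos hg0 hl))
      (Nat.dvd_gcd (dvd_mul_right _ _) (dvd_mul_right _ _))
  have hle' : (g : ℚ) ≤ (Nat.gcd (g * l) (g * (2 * l + 1)) : ℕ) := by exact_mod_cast hle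
  have hq : (0 : ℚ) < (g * l : ℕ) := by exact_mod_cast Nat.mul_pos hg0 hl
  have hm : (2 : ℚ) ≤ (g * (2 * l + 1) : ℕ) := by exact_mod_cast hM2
  have key : (((g * (2 * l + 1) : ℕ) : ℚ) - 1) *
      ((g * (2 * l + 1) : ℕ) - (Nat.gcd (g * l) (g * (2 * l + 1)) : ℕ)) / (g * l : ℕ) ≤
      2 * ((g * (2 * l + 1) : ℕ) - 1) := by
    rw [div_le_iff₀ hq]
    have : ((g * (2 * l + 1) : ℕ) : ℚ) - (Nat.gcd (g * l) (g * (2 * l + 1)) : ℕ) ≤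
        2 * (g * l : ℕ) := by
      push_cast at hle' ⊢
      linarith
    nlinarith
  refine add_le_add (add_le_add key ?_) le_rfl
  push_cast
  linarith

theorem exists_dvd_of_isComposite {M : ℕ} (hM : Odd M) (hc : IsComposite M) :
    ∃ g, g ∣ M ∧ 3 ≤ g ∧ 3 * g ≤ M := by
  obtain ⟨h1, hp⟩ := hc
  have hdvd := Nat.minFac_dvd M
  obtain ⟨h, hh⟩ := hdvd
  have hodd := Nat.odd_mul.1 (hh ▸ hM)
  have hg1 : M.minFac ≠ 1 := fun h => by rw [Nat.minFac_eq_one_iff] at h; omega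
  have hh1 : h ≠ 1 := by
    rintro rfl
    rw [mul_one] at hh
    exact hp (hh ▸ Nat.minFac_prime (by omega))
  have hg3 : 3 ≤ M.minFac := by
    obtain ⟨k, hk⟩ := hodd.1; omega
  have hh3 : 3 ≤ h := by
    obtain ⟨k, hk⟩ := hodd.2; omega
  refine ⟨M.minFac, ⟨h, hh⟩, hg3, ?_⟩
  rw [mul_comm]
  conv_rhs => rw [hh]
  exact Nat.mul_le_mul_left _ hh3

/-- Optimal solutions of the aperiodic instance. For `g = gcd q₁ M`, the cost of `q₁` is
`(M - 1) * (M - g) / q₁ + 4 * q₁` up to a constant. This is at least `4 * (M - 1)` for `g = 1` and for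
`g = M`, but less at the best `q₁` for a nontrivial divisor. The last part makes it possible to read
off the divisor of `M` without computing a greatest common divisor. -/
theorem IsOptimal.of_aperiodicInstance {M : ℕ} (hM : Odd M) (hc : IsComposite M) {q₁ q₂ : ℕ}
    (h : IsOptimal (aperiodicInstance M).aperiodicCost q₁ q₂) :
    q₂ = M ∧ 1 < Nat.gcd q₁ M ∧ Nat.gcd q₁ M < M ∧ 2 * q₁ + Nat.gcd q₁ M = M := by
  obtain ⟨h₁, h₂, hopt⟩ := h
  have hM2 : 2 ≤ M := hc.1
  obtain ⟨g₀, hg₀, hg₀3, hg₀M⟩ := exists_dvd_of_isComposite hM hc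
  obtain ⟨r, hr, hcr⟩ := exists_aperiodicCost_le hM hM2 hg₀ (by omega)
  have hle := (hopt r M hr (by omega)).trans hcr
  have hg3 : (3 : ℚ) ≤ g₀ := by exact_mod_cast hg₀3
  have hgM : (3 * g₀ : ℚ) ≤ M := by exact_mod_cast hg₀M
  have hq : (0 : ℚ) < q₁ := by exact_mod_cast h₁
  have hq2 : q₂ = M := by
    by_contra hne
    have := le_aperiodicCost_of_ne hM2 h₁ h₂ hne
    nlinarith
  subst hq2
  set M := q₂
  set g := Nat.gcd q₁ M with hg
  have hgdvd : g ∣ M := Nat.gcd_dvd_right _ _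
  have hgpos : 0 < g := Nat.gcd_pos_of_pos_left _ h₁
  rw [aperiodicCost_aperiodicInstance_self hM2 h₁] at hle
  have hgne : g ≠ M := by
    intro hgM'
    -- a multiple of `M` has too large a holding cost
    have hle' : (M : ℚ) ≤ q₁ := by
      exact_mod_cast hgM'.symm.le.trans (Nat.le_of_dvd h₁ (Nat.gcd_dvd_left q₁ M))
    rw [← hg, hgM', sub_self, mul_zero, zero_div] at hle
    linarith
  have hgne1 : g ≠ 1 := by
    intro hg1
    rw [← hg, hg1] at hle
    push_cast at hle
    -- without a common divisor, the arithmetic-geometric mean inequality bounds the cost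
    have hamgm : 4 * ((M : ℚ) - 1) ≤ (M - 1) * (M - 1) / q₁ + 4 * q₁ := by
      rw [div_add' _ _ _ hq.ne', le_div_iff₀ hq]
      nlinarith [sq_nonneg ((M : ℚ) - 1 - 2 * q₁)]
    linarith
  have hglt : g < M := lt_of_le_of_ne (Nat.le_of_dvd (by omega) hgdvd) hgne
  refine ⟨rfl, by omega, hglt, ?_⟩
  -- comparison with the solution `(M - g) / 2` confines `2 * q₁` to `[M - g, M - 1]`
  obtain ⟨r', hr', hcr'⟩ := exists_aperiodicCost_le hM hM2 hgdvd hglt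
  have hle2 := (hopt r' M hr' (by omega)).trans hcr'
  rw [aperiodicCost_aperiodicInstance_self hM2 h₁, ← hg] at hle2
  have hprod : (2 * (q₁ : ℚ) - (M - 1)) * (2 * q₁ - (M - g)) ≤ 0 := by
    have h3 : ((M : ℚ) - 1) * (M - g) / q₁ + 4 * q₁ ≤ 2 * (M - 1) + 2 * (M - g) := by linarith
    rw [div_add' _ _ _ hq.ne', div_le_iff₀ hq] at h3
    nlinarith
  have hprod' : (2 * (q₁ : ℤ) - (M - 1)) * (2 * q₁ - (M - g)) ≤ 0 := by exact_mod_cast hprod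
  have hlow : (M : ℤ) - g ≤ 2 * q₁ := by
    by_contra hcon
    push Not at hcon
    have : 0 < (2 * (q₁ : ℤ) - (M - 1)) * (2 * q₁ - (M - g)) :=
      mul_pos_of_neg_of_neg (by omega) (by omega)
    omega
  have hupp : 2 * (q₁ : ℤ) ≤ M - 1 := by
    by_contra hcon
    push Not at hcon
    have : 0 < (2 * (q₁ : ℤ) - (M - 1)) * (2 * q₁ - (M - g)) :=
      mul_pos (by omega) (by omega)
    omega
  -- the only positive multiple of `g` below `g + 1` is `g`
  have hd : g ∣ M - 2 * q₁ :=
    Nat.dvd_sub hgdvd (Dvd.dvd.mul_left (Nat.gcd_dvd_left _ _) _)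
  have hge := Nat.le_of_dvd (by omega) hd
  omega

theorem periodicCost_periodicInstance (M q₁ q₂ : ℕ) :
    (periodicInstance M).periodicCost q₁ q₂ =
      q₁ + ((M : ℚ) ^ 3 * (M + 1) / q₂ + M * (M + 1) * q₂) + M / (Nat.gcd q₁ q₂ : ℕ) := by
  simp [periodicCost, eoq, periodicInstance]

/-- A second period other than `M` costs at least `M` more than `M`: its own cost exceeds the minimum
by `M * (M + 1) * (q₂ - M) ^ 2 / q₂`. -/
theorem le_periodicCost_of_ne {M : ℕ} (hM : 2 ≤ M) {q₁ q₂ : ℕ} (h₁ : 0 < q₁) (h₂ : 0 < q₂)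
    (hne : q₂ ≠ M) :
    1 + 2 * (M : ℚ) ^ 2 * (M + 1) + M ≤ (periodicInstance M).periodicCost q₁ q₂ := by
  have hM2 : (2 : ℚ) ≤ M := by exact_mod_cast hM
  have hq₁ : (1 : ℚ) ≤ q₁ := by exact_mod_cast h₁
  have hq₂ : (0 : ℚ) < q₂ := by exact_mod_cast h₂
  have e1 : (0 : ℚ) ≤ M / (Nat.gcd q₁ q₂ : ℕ) := by positivity
  have e2 := le_mul_sq_sub hne
  have e3 : (M : ℚ) ^ 3 * (M + 1) / q₂ + M * (M + 1) * q₂ =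
      2 * M ^ 2 * (M + 1) + M * ((M + 1) * (q₂ - M) ^ 2 / q₂) := by
    field_simp
    ring
  have e4 : 1 ≤ ((M : ℚ) + 1) * (q₂ - M) ^ 2 / q₂ := by rwa [le_div_iff₀ hq₂, one_mul]
  have e5 : (M : ℚ) ≤ M * ((M + 1) * (q₂ - M) ^ 2 / q₂) :=
    le_mul_of_one_le_right (by linarith) e4
  rw [periodicCost_periodicInstance, e3]
  linarith

theorem periodicCost_periodicInstance_self {M : ℕ} (hM : 0 < M) (q₁ : ℕ) :
    (periodicInstance M).periodicCost q₁ M =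
      q₁ + 2 * (M : ℚ) ^ 2 * (M + 1) + M / (Nat.gcd q₁ M : ℕ) := by
  have hM0 : (M : ℚ) ≠ 0 := by exact_mod_cast hM.ne'
  rw [periodicCost_periodicInstance]
  field_simp
  ring

/-- Optimal solutions of the periodic instance: the first period is itself a divisor of `M`. -/
theorem IsOptimal.of_periodicInstance {M : ℕ} (hM : Odd M) (hc : IsComposite M) {q₁ q₂ : ℕ}
    (h : IsOptimal (periodicInstance M).periodicCost q₁ q₂) :
    q₂ = M ∧ 1 < Nat.gcd q₁ M ∧ Nat.gcd q₁ M < M ∧ q₁ = Nat.gcd q₁ M := by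
  obtain ⟨h₁, h₂, hopt⟩ := h
  have hM2 : 2 ≤ M := hc.1
  obtain ⟨g₀, hg₀, hg₀3, hg₀M⟩ := exists_dvd_of_isComposite hM hc
  have hle := hopt g₀ M (by omega) (by omega)
  rw [periodicCost_periodicInstance_self (by omega), Nat.gcd_eq_left hg₀] at hle
  have hg3 : (3 : ℚ) ≤ g₀ := by exact_mod_cast hg₀3
  have hgM : (3 * g₀ : ℚ) ≤ M := by exact_mod_cast hg₀M
  have hq : (1 : ℚ) ≤ q₁ := by exact_mod_cast h₁
  have hM0 : (0 : ℚ) < M := by linarith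
  -- a nontrivial divisor is cheaper than a trivial one
  have hlt : (g₀ : ℚ) + M / g₀ < 1 + M := by
    rw [add_div' _ _ _ (by linarith), div_lt_iff₀ (by linarith)]
    nlinarith
  have hq2 : q₂ = M := by
    by_contra hne
    have := le_periodicCost_of_ne hM2 h₁ h₂ hne
    linarith
  subst hq2
  set M := q₂
  set g := Nat.gcd q₁ M with hg
  have hgdvd : g ∣ M := Nat.gcd_dvd_right _ _
  have hgpos : 0 < g := Nat.gcd_pos_of_pos_left _ h₁
  have hgq : g ≤ q₁ := Nat.le_of_dvd h₁ (Nat.gcd_dvd_left _ _)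
  rw [periodicCost_periodicInstance_self (by omega), ← hg] at hle
  have hgne : g ≠ M := by
    intro hgM'
    have hle' : (M : ℚ) ≤ q₁ := by exact_mod_cast hgM'.symm.le.trans hgq
    rw [hgM', div_self hM0.ne'] at hle
    linarith
  have hgne1 : g ≠ 1 := by
    intro hg1
    rw [hg1] at hle
    push_cast at hle
    linarith
  refine ⟨rfl, by omega, lt_of_le_of_ne (Nat.le_of_dvd (by omega) hgdvd) hgne, ?_⟩
  have hle2 := hopt g M hgpos (by omega)
  rw [periodicCost_periodicInstance_self (by omega), periodicCost_periodicInstance_self (by omega),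
    ← hg, Nat.gcd_eq_left hgdvd] at hle2
  have : (q₁ : ℚ) ≤ g := by linarith
  exact le_antisymm (by exact_mod_cast this) hgq

theorem forcesDivisor_aperiodicInstance {M : ℕ} (hM : Odd M) (hc : IsComposite M) :
    ForcesDivisor (aperiodicInstance M).aperiodicCost M := by
  refine ⟨exists_isOptimal fun q₁ q₂ h₁ h₂ =>
    add_le_aperiodicCost (isAperiodicInstance_aperiodicInstance hc.1) h₁ h₂, fun q₁ q₂ h => ?_⟩
  obtain ⟨h1, h2, h3, -⟩ := h.of_aperiodicInstance hM hc
  exact ⟨h1, h2, h3⟩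

theorem forcesDivisor_periodicInstance {M : ℕ} (hM : Odd M) (hc : IsComposite M) :
    ForcesDivisor (periodicInstance M).periodicCost M := by
  refine ⟨exists_isOptimal fun q₁ q₂ _ _ =>
    add_le_periodicCost (isPeriodicInstance_periodicInstance (by have := hc.1; omega)),
    fun q₁ q₂ h => ?_⟩
  obtain ⟨h1, h2, h3, -⟩ := h.of_periodicInstance hM hc
  exact ⟨h1, h2, h3⟩

end TwoItemJRP

/-! ### Finding a divisor by one call -/

theorem Polynomial.eval_le_eval_nat (p : Polynomial ℕ) {a b : ℕ} (h : a ≤ b) :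
    p.eval a ≤ p.eval b := by
  rw [Polynomial.eval_eq_sum_range, Polynomial.eval_eq_sum_range]
  exact Finset.sum_le_sum fun i _ => Nat.mul_le_mul_left _ (Nat.pow_le_pow_left h i)

theorem encodeNats_cons (n : ℕ) (l : List ℕ) :
    encodeNats (n :: l) = numWord n ++ .comma :: encodeNats l := by
  simp [encodeNats, numWord]

theorem encodeNats_nil : encodeNats [] = [] := rfl

theorem length_encodeNats_le {k : ℕ} (l : List ℕ) (h : ∀ n ∈ l, n < 2 ^ k) :
    (encodeNats l).length ≤ l.length * (k + 1) := by
  induction l with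
  | nil => simp [encodeNats_nil]
  | cons n l ih =>
    have h1 := length_numWord_le (h n (by simp))
    have h2 := ih fun m hm => h m (by simp [hm])
    simp only [encodeNats_cons, List.length_append, List.length_cons]
    nlinarith

namespace Prog

variable {tm : FinTM2}

section

variable {r d : Reg} {s : Reg → List Γ'} {k m : ℕ}

theorem exec_clear_num (hm : m < 2 ^ k) (hr : s r = numWord m) :
    (clear tm r).Exec s (update s r []) (arithTime k) := by
  refine (exec_clear r s).mono ?_
  have := length_numWord_le hm
  rw [hr, arithTime]; nlinarith

theorem exec_copy_num (hm : m < 2 ^ k) (hr : s r = numWord m) (hrd : r ≠ d) (h1 : r ≠ .lx)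
    (h2 : d ≠ .lx) (hs : Clean s) (hd : s d = []) :
    (copy tm r d).Exec s (update s d (numWord m)) (arithTime k) := by
  refine hr ▸ (exec_copy hrd h1 h2 (hs _ rfl) hd).mono ?_
  have := length_numWord_le hm
  rw [hr, arithTime]; nlinarith

theorem exec_emit_num (hm : m < 2 ^ k) (hr : s r = numWord m) (hrd : r ≠ d) (h1 : r ≠ .lx)
    (h2 : d ≠ .lx) (hs : Clean s) :
    (emit tm r d).Exec s (update s d (numWord m ++ .comma :: s d)) (arithTime k) := by
  refine hr ▸ (exec_emit hrd h1 h2 (hs _ rfl)).mono ?_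
  have := length_numWord_le hm
  rw [hr, arithTime]; nlinarith

end

/-- The registers used while looking for a divisor are empty. -/
def Idle (s : Reg → List Γ') : Prop :=
  Clean s ∧ s .query = [] ∧ s .answer = [] ∧ s .tmp = [] ∧ s .u₁ = [] ∧ s .u₂ = [] ∧ s .u₃ = []

/-- Compute the three large coefficients `M * (M - 1)`, `M * (M ^ 2 - 1)` and `M ^ 3 * (M ^ 2 - 1)` of
the aperiodic instance for the odd number `M` in `num`, and put them into `u₂`, `u₁` and `tmp`. The
predecessor of `M` is obtained by replacing the lowest digit by `0`. -/
noncomputable def computeAperiodic (tm : FinTM2) : Prog tm Reg :=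
  (copy tm .num .u₁).seq <| (popSym tm .u₁).seq <| (pushSym tm .u₁ (.bit false)).seq <|
  (mul tm .num .u₁ .u₂).seq <| (clear tm .u₁).seq <| (pushSym tm .u₁ (.bit true)).seq <|
  (add tm .num .u₁ .u₃).seq <| (clear tm .u₁).seq <| (mul tm .u₂ .u₃ .u₁).seq <|
  (clear tm .u₃).seq <| (mul tm .u₁ .num .u₃).seq <| (mul tm .u₃ .num .tmp).seq (clear tm .u₃)

/-- Write the coefficients of the aperiodic instance into `query`, the last one first, given the large
ones. -/
noncomputable def emitAperiodic (tm : FinTM2) : Prog tm Reg :=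
  (emit tm .u₁ .query).seq <| (emit tm .tmp .query).seq <|
  (pushSym tm .u₃ (.bit true)).seq <| (pushSym tm .u₃ (.bit false)).seq <|
  (pushSym tm .u₃ (.bit false)).seq <| (emit tm .u₃ .query).seq <| (emit tm .u₂ .query).seq <|
  (emit tm .u₂ .query).seq <| (clear tm .u₁).seq <| (clear tm .u₂).seq <| (clear tm .u₃).seq
  (clear tm .tmp)

/-- Write the coefficients of the periodic instance for the number in `num` into `query`, the last one
first. -/
noncomputable def writePeriodic (tm : FinTM2) : Prog tm Reg :=
  (pushSym tm .u₁ (.bit true)).seq <| (add tm .num .u₁ .u₂).seq <| (mul tm .num .u₂ .u₃).seq <|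
  (clear tm .u₂).seq <| (mul tm .u₃ .num .u₂).seq <| (mul tm .u₂ .num .tmp).seq <|
  (emit tm .u₃ .query).seq <| (emit tm .tmp .query).seq <| (emit tm .u₁ .query).seq <|
  (clear tm .u₁).seq <| (emit tm .u₁ .query).seq <| (emit tm .num .query).seq <|
  (clear tm .u₂).seq <| (clear tm .u₃).seq (clear tm .tmp)

theorem one_le_arithTime (k : ℕ) : 1 ≤ arithTime k := by
  unfold arithTime
  have := Nat.one_le_pow 2 (k + 1) (by omega)
  omega

theorem exec_writePeriodic {k M : ℕ} (hM : 2 ≤ M) (hk : M < 2 ^ k) {s : Reg → List Γ'}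
    (hs : Idle s) (hnum : s .num = numWord M) :
    (writePeriodic tm).Exec s
      (update s .query (encodeNats (TwoItemJRP.periodicInstance M).coeffs))
      (15 * arithTime (5 * k)) := by
  obtain ⟨hc, hs⟩ := hs
  have hpow : M ^ 5 < 2 ^ (5 * k) := by
    rw [mul_comm, pow_mul]; exact Nat.pow_lt_pow_left hk (by norm_num)
  have hle : ∀ {a}, a ≤ M ^ 5 → a < 2 ^ (5 * k) := fun h => h.trans_lt hpow
  have b0 : M < 2 ^ (5 * k) := hle (Nat.le_self_pow (by norm_num) M)
  have b1 : 1 < 2 ^ (5 * k) := hle (Nat.one_le_pow _ _ (by omega))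
  have bz : 0 < 2 ^ (5 * k) := by omega
  have c2 : M * (M + 1) ≤ M ^ 3 := calc
    M * (M + 1) ≤ M * M ^ 2 := Nat.mul_le_mul_left _ (by nlinarith)
    _ = M ^ 3 := by ring
  have b2 : M + 1 < 2 ^ (5 * k) := hle (calc
    M + 1 ≤ M ^ 2 := by nlinarith
    _ ≤ M ^ 5 := Nat.pow_le_pow_right (by omega) (by norm_num))
  have b3 : M * (M + 1) < 2 ^ (5 * k) :=
    hle (c2.trans (Nat.pow_le_pow_right (by omega) (by norm_num)))
  have b4 : M * (M + 1) * M < 2 ^ (5 * k) := hle (calc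
    M * (M + 1) * M ≤ M ^ 3 * M := Nat.mul_le_mul_right _ c2
    _ = M ^ 4 := by ring
    _ ≤ M ^ 5 := Nat.pow_le_pow_right (by omega) (by norm_num))
  have b5 : M * (M + 1) * M * M < 2 ^ (5 * k) := hle (calc
    M * (M + 1) * M * M ≤ M ^ 3 * M * M := by gcongr
    _ = M ^ 5 := by ring)
  have hone := one_le_arithTime (5 * k)
  refine (Exec.seq ((exec_pushSym _ _ _).mono hone) <|
    Exec.seq (exec_add (m := M) (n := 1) rfl rfl rfl (by repeat' first | exact hc | refine Clean.update ?_ rfl _)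
      b0 b1 (by simp [hnum]) (by simp [hs]) (by simp [hs])) <|
    Exec.seq (exec_mul (m := M) (n := M + 1) rfl rfl rfl
      (by repeat' first | exact hc | refine Clean.update ?_ rfl _) b0 b2 (by simp [hnum]) (by simp)
      (by simp [hs])) <|
    Exec.seq (exec_clear_num b2 (by simp)) <|
    Exec.seq (exec_mul (m := M * (M + 1)) (n := M) rfl rfl rfl
      (by repeat' first | exact hc | refine Clean.update ?_ rfl _) b3 b0 (by simp) (by simp [hnum])
      (by simp)) <|
    Exec.seq (exec_mul (m := M * (M + 1) * M) (n := M) rfl rfl rfl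
      (by repeat' first | exact hc | refine Clean.update ?_ rfl _) b4 b0 (by simp) (by simp [hnum])
      (by simp [hs])) <|
    Exec.seq (exec_emit_num b3 (by simp) (by simp) (by simp) (by simp)
      (by repeat' first | exact hc | refine Clean.update ?_ rfl _)) <|
    Exec.seq (exec_emit_num b5 (by simp) (by simp) (by simp) (by simp)
      (by repeat' first | exact hc | refine Clean.update ?_ rfl _)) <|
    Exec.seq (exec_emit_num b1 (by simp [hs]) (by simp) (by simp) (by simp)
      (by repeat' first | exact hc | refine Clean.update ?_ rfl _)) <|
    Exec.seq (exec_clear_num b1 (by simp [hs])) <|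
    Exec.seq (exec_emit_num bz (by simp) (by simp) (by simp) (by simp)
      (by repeat' first | exact hc | refine Clean.update ?_ rfl _)) <|
    Exec.seq (exec_emit_num b0 (by simp [hnum]) (by simp) (by simp) (by simp)
      (by repeat' first | exact hc | refine Clean.update ?_ rfl _)) <|
    Exec.seq (exec_clear_num b4 (by simp)) <|
    Exec.seq (exec_clear_num b3 (by simp))
      (exec_clear_num b5 (by simp))).congr ?_ (by omega)
  have e1 : M ^ 3 * (M + 1) = M * (M + 1) * M * M := by ring
  funext v
  cases v <;> simp [hs, TwoItemJRP.coeffs, TwoItemJRP.periodicInstance, encodeNats_cons,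
    encodeNats_nil, e1]

theorem exec_computeAperiodic {k M N : ℕ} (hM : Odd M) (hM2 : 2 ≤ M) (hNM : N + 1 = M)
    (hk : M < 2 ^ k) {s : Reg → List Γ'} (hs : Idle s) (hnum : s .num = numWord M) :
    (computeAperiodic tm).Exec s
      (update (update (update s .u₂ (numWord (M * N))) .u₁ (numWord (M * N * (M + 1)))) .tmp
        (numWord (M * N * (M + 1) * M * M)))
      (13 * arithTime (5 * k)) := by
  obtain ⟨hc, hs⟩ := hs
  have hpow : M ^ 5 < 2 ^ (5 * k) := by
    rw [mul_comm, pow_mul]; exact Nat.pow_lt_pow_left hk (by norm_num)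
  have hle : ∀ {a}, a ≤ M ^ 5 → a < 2 ^ (5 * k) := fun h => h.trans_lt hpow
  obtain ⟨l, hl⟩ := hM
  have hl0 : l ≠ 0 := by omega
  have hN : N = 2 * l := by omega
  have hNw : numWord N = .bit false :: numWord l := by
    rw [hN]; exact numWord_bit false l (.inl hl0)
  have hMw : numWord M = .bit true :: numWord l := by
    rw [hl]; exact numWord_bit true l (.inl hl0)
  have b0 : M < 2 ^ (5 * k) := hle (Nat.le_self_pow (by norm_num) M)
  have b1 : 1 < 2 ^ (5 * k) := hle (Nat.one_le_pow _ _ (by omega))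
  have bN : N < 2 ^ (5 * k) := by omega
  have c2 : M * N ≤ M ^ 2 := by nlinarith
  have b2 : M * N < 2 ^ (5 * k) :=
    hle (c2.trans (Nat.pow_le_pow_right (by omega) (by norm_num)))
  have b3 : M + 1 < 2 ^ (5 * k) := hle (calc
    M + 1 ≤ M ^ 2 := by nlinarith
    _ ≤ M ^ 5 := Nat.pow_le_pow_right (by omega) (by norm_num))
  have c5 : M * N * (M + 1) ≤ M ^ 3 := by
    have : N * (M + 1) ≤ M ^ 2 := by subst hNM; nlinarith
    calc M * N * (M + 1) = M * (N * (M + 1)) := by ring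
      _ ≤ M * M ^ 2 := Nat.mul_le_mul_left _ this
      _ = M ^ 3 := by ring
  have b5 : M * N * (M + 1) < 2 ^ (5 * k) :=
    hle (c5.trans (Nat.pow_le_pow_right (by omega) (by norm_num)))
  have b6 : M * N * (M + 1) * M < 2 ^ (5 * k) := hle (calc
    M * N * (M + 1) * M ≤ M ^ 3 * M := Nat.mul_le_mul_right _ c5
    _ = M ^ 4 := by ring
    _ ≤ M ^ 5 := Nat.pow_le_pow_right (by omega) (by norm_num))
  have b7 : M * N * (M + 1) * M * M < 2 ^ (5 * k) := hle (calc
    M * N * (M + 1) * M * M ≤ M ^ 3 * M * M := by gcongr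
    _ = M ^ 5 := by ring)
  have hone := one_le_arithTime (5 * k)
  refine (Exec.seq (exec_copy_num b0 hnum (by simp) (by simp) (by simp) hc (by simp [hs])) <|
    Exec.seq ((exec_popSym _ _).mono hone) <|
    Exec.seq ((exec_pushSym _ _ _).mono hone) <|
    Exec.seq (exec_mul (m := M) (n := N) rfl rfl rfl
      (by repeat' first | exact hc | refine Clean.update ?_ rfl _) b0 bN (by simp [hnum])
      (by simp [hMw, hNw]) (by simp [hs])) <|
    Exec.seq (exec_clear_num bN (by simp [hMw, hNw])) <|
    Exec.seq ((exec_pushSym _ _ _).mono hone) <|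
    Exec.seq (exec_add (m := M) (n := 1) rfl rfl rfl
      (by repeat' first | exact hc | refine Clean.update ?_ rfl _) b0 b1 (by simp [hnum])
      (by simp) (by simp [hs])) <|
    Exec.seq (exec_clear_num b1 (by simp)) <|
    Exec.seq (exec_mul (m := M * N) (n := M + 1) rfl rfl rfl
      (by repeat' first | exact hc | refine Clean.update ?_ rfl _) b2 b3 (by simp) (by simp)
      (by simp)) <|
    Exec.seq (exec_clear_num b3 (by simp)) <|
    Exec.seq (exec_mul (m := M * N * (M + 1)) (n := M) rfl rfl rfl
      (by repeat' first | exact hc | refine Clean.update ?_ rfl _) b5 b0 (by simp)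
      (by simp [hnum]) (by simp)) <|
    Exec.seq (exec_mul (m := M * N * (M + 1) * M) (n := M) rfl rfl rfl
      (by repeat' first | exact hc | refine Clean.update ?_ rfl _) b6 b0 (by simp)
      (by simp [hnum]) (by simp [hs])) <|
    exec_clear_num b6 (by simp)).congr ?_ (by omega)
  funext v
  cases v <;> simp [hs]

theorem exec_emitAperiodic {k a b c : ℕ} (ha : a < 2 ^ k) (hb : b < 2 ^ k) (hd : c < 2 ^ k)
    (h4 : 4 < 2 ^ k) {s : Reg → List Γ'} (hc : Clean s) (hu₁ : s .u₁ = numWord b)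
    (hu₂ : s .u₂ = numWord a) (htmp : s .tmp = numWord c) (hu₃ : s .u₃ = [])
    (hq : s .query = []) :
    (emitAperiodic tm).Exec s
      (update (update (update (update s .query (encodeNats [a, a, 4, c, b])) .u₁ []) .u₂ [])
        .tmp []) (12 * arithTime k) := by
  obtain ⟨n, hn⟩ : ∃ n, n = 4 := ⟨_, rfl⟩
  have h4w : numWord n = [.bit false, .bit false, .bit true] := by
    rw [hn, numWord_of_ne_zero (by norm_num), numWord_of_ne_zero (by norm_num)]
    simp
  rw [← hn] at h4 ⊢
  have hone := one_le_arithTime k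
  refine (Exec.seq (exec_emit_num hb hu₁ (by simp) (by simp) (by simp) hc) <|
    Exec.seq (exec_emit_num hd (by simp [htmp]) (by simp) (by simp) (by simp)
      (by repeat' first | exact hc | refine Clean.update ?_ rfl _)) <|
    Exec.seq ((exec_pushSym _ _ _).mono hone) <|
    Exec.seq ((exec_pushSym _ _ _).mono hone) <|
    Exec.seq ((exec_pushSym _ _ _).mono hone) <|
    Exec.seq (exec_emit_num h4 (by simp [h4w, hu₃]) (by simp) (by simp) (by simp)
      (by repeat' first | exact hc | refine Clean.update ?_ rfl _)) <|
    Exec.seq (exec_emit_num ha (by simp [hu₂]) (by simp) (by simp) (by simp)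
      (by repeat' first | exact hc | refine Clean.update ?_ rfl _)) <|
    Exec.seq (exec_emit_num ha (by simp [hu₂]) (by simp) (by simp) (by simp)
      (by repeat' first | exact hc | refine Clean.update ?_ rfl _)) <|
    Exec.seq (exec_clear_num hb (by simp [hu₁])) <|
    Exec.seq (exec_clear_num ha (by simp [hu₂])) <|
    Exec.seq (exec_clear_num h4 (by simp [h4w, hu₃]))
      (exec_clear_num hd (by simp [htmp]))).congr ?_ (by omega)
  funext v
  cases v <;> simp [hu₃, hq, encodeNats_cons, encodeNats_nil]

theorem exec_writeAperiodic {k M : ℕ} (hM : Odd M) (hM2 : 2 ≤ M) (hk : M < 2 ^ k)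
    {s : Reg → List Γ'} (hs : Idle s) (hnum : s .num = numWord M) :
    ((computeAperiodic tm).seq (emitAperiodic tm)).Exec s
      (update s .query (encodeNats (TwoItemJRP.aperiodicInstance M).coeffs))
      (25 * arithTime (5 * k)) := by
  have hc := hs.1
  have hs' := hs.2
  have hpow : M ^ 5 < 2 ^ (5 * k) := by
    rw [mul_comm, pow_mul]; exact Nat.pow_lt_pow_left hk (by norm_num)
  obtain ⟨N, hNM⟩ : ∃ N, N + 1 = M := ⟨M - 1, by omega⟩
  have e0 : M - 1 = N := by omega
  have e1 : M ^ 2 - 1 = N * (M + 1) := by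
    subst hNM
    have : (N + 1) ^ 2 = N * (N + 1 + 1) + 1 := by ring
    omega
  have e2 : M ^ 3 * (N * (M + 1)) = M * N * (M + 1) * M * M := by ring
  have e3 : M * (N * (M + 1)) = M * N * (M + 1) := by ring
  have hle := TwoItemJRP.coeffs_aperiodicInstance_le hM2
  simp only [TwoItemJRP.coeffs, TwoItemJRP.aperiodicInstance, e0, e1, e2, e3, List.mem_cons,
    List.not_mem_nil, or_false, forall_eq_or_imp, forall_eq] at hle ⊢
  obtain ⟨-, ha, h4, hd, hb⟩ := hle
  refine (Exec.seq (exec_computeAperiodic hM hM2 hNM hk hs hnum)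
    (exec_emitAperiodic (ha.trans_lt hpow) (hb.trans_lt hpow) (hd.trans_lt hpow)
      (h4.trans_lt hpow) (by repeat' first | exact hc | refine Clean.update ?_ rfl _)
      (by simp) (by simp) (by simp) (by simp [hs']) (by simp [hs']))).congr ?_ (by omega)
  funext v
  cases v <;> simp [hs']

/-- Run the machine `tm` on the word in `query`, and put the first of the two numbers that it
outputs into `u₁`. -/
noncomputable def ask (e₀ : tm.Γ tm.k₀ ≃ Γ') (e₁ : tm.Γ tm.k₁ ≃ Γ') : Prog tm Reg :=
  (call e₀ e₁ .query .lx .answer).seq <| (parse tm .answer .u₁).seq <|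
    (parse tm .answer .u₂).seq (clear tm .u₂)

theorem exec_ask {e₀ : tm.Γ tm.k₀ ≃ Γ'} {e₁ : tm.Γ tm.k₁ ≃ Γ'} {w : List Γ'} {q₁ q₂ k t : ℕ}
    (h₁ : q₁ < 2 ^ k) (h₂ : q₂ < 2 ^ k)
    (h : TM2OutputsInTime tm (w.map e₀.symm) (some ((encodeNats [q₁, q₂]).map e₁.symm)) t)
    {s : Reg → List Γ'} (hs : Idle s) :
    (ask e₀ e₁).Exec (update s .query w) (update s .u₁ (numWord q₁))
      (t + 3 * w.length + arithTime k) := by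
  obtain ⟨hc, hs⟩ := hs
  have hlen : (encodeNats [q₁, q₂]).length ≤ 2 * (k + 1) :=
    length_encodeNats_le [q₁, q₂] (by simp [h₁, h₂])
  have l1 := length_numWord_le h₁
  have l2 := length_numWord_le h₂
  refine (Exec.seq (exec_call (by simp) (by simp) h (by simp) (by simpa using hc _ rfl)
      (by simp [hs])) <|
    Exec.seq (exec_parse (n := q₁) (l := encodeNats [q₂]) (by simp) (by simp) (by simp)
      (by simp [hc .lx rfl]) (by simp [hs]) (by simp [encodeNats_cons])) <|
    Exec.seq (exec_parse (n := q₂) (l := []) (by simp) (by simp) (by simp)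
      (by simp [hc .lx rfl]) (by simp [hs]) (by simp [encodeNats_cons, encodeNats_nil])) <|
    exec_clear _ _).congr ?_ ?_
  · funext v
    cases v <;> simp [hs]
  · have : 20 * (k + 1) ≤ arithTime k := by unfold arithTime; nlinarith
    simp
    omega

/-- A program that, given an odd number in `num`, finds in polynomial time a candidate for a
nontrivial divisor. It only has to be right if the number is composite. The bound on the candidate
comes from the sum of the five coefficients of an instance, each of which is at most `M ^ 5`. -/
def IsDivisorFinder (F : Prog tm Reg) (p : Polynomial ℕ) : Prop :=
  ∀ (k M : ℕ) (s : Reg → List Γ'), Odd M → 2 ≤ M → M < 2 ^ k → Idle s → s .num = numWord M →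
    s .fac = [] → ∃ d, 0 < d ∧ d < 2 ^ (5 * k + 4) ∧
      (IsComposite M → d ∣ M ∧ 1 < d ∧ d < M) ∧ F.Exec s (update s .fac (numWord d)) (p.eval k)

end Prog

namespace TwoItemJRP

theorem sum_coeffs_lt {I : TwoItemJRP} {M k : ℕ} (hk : M < 2 ^ k)
    (h : ∀ c ∈ I.coeffs, c ≤ M ^ 5) : 2 * I.coeffs.sum < 2 ^ (5 * k + 4) := by
  have hpow : M ^ 5 < 2 ^ (5 * k) := by
    rw [mul_comm, pow_mul]; exact Nat.pow_lt_pow_left hk (by norm_num)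
  simp only [coeffs, List.mem_cons, List.not_mem_nil, or_false, forall_eq_or_imp, forall_eq] at h
  simp only [coeffs, List.sum_cons, List.sum_nil, pow_add]
  omega

theorem length_encodeNats_coeffs_le {I : TwoItemJRP} {M k : ℕ} (hk : M < 2 ^ k)
    (h : ∀ c ∈ I.coeffs, c ≤ M ^ 5) : (encodeNats I.coeffs).length ≤ 25 * k + 5 := by
  have hpow : M ^ 5 < 2 ^ (5 * k) := by
    rw [mul_comm, pow_mul]; exact Nat.pow_lt_pow_left hk (by norm_num)
  have := length_encodeNats_le (k := 5 * k) I.coeffs (fun c hc => (h c hc).trans_lt hpow)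
  have hl : I.coeffs.length = 5 := rfl
  rw [hl] at this
  omega

end TwoItemJRP

/-- The polynomial that bounds the time of the arithmetical operations on numbers below
`2 ^ (5 * k + 4)`. -/
noncomputable def arithPoly : Polynomial ℕ := 100 * (5 * Polynomial.X + 5) ^ 2

theorem eval_arithPoly (k : ℕ) : arithPoly.eval k = Prog.arithTime (5 * k + 4) := by
  simp [arithPoly, Prog.arithTime]

theorem Prog.arithTime_mono {k l : ℕ} (h : k ≤ l) : arithTime k ≤ arithTime l := by
  unfold arithTime; gcongr

namespace Prog

/-- A polynomial time algorithm for the aperiodic problem yields a divisor finder: the divisor is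
`M - 2 * q₁`. If this is negative, which cannot happen for a composite `M`, the candidate is `M`. -/
theorem exists_isDivisorFinder_of_aperiodic (H : TwoItemJRP.AperiodicInPolyTime) :
    ∃ (tm : FinTM2) (F : Prog tm Reg) (p : Polynomial ℕ), IsDivisorFinder F p := by
  obtain ⟨f, ⟨C⟩, hf⟩ := H
  refine ⟨C.tm, ((computeAperiodic C.tm).seq (emitAperiodic C.tm)).seq <| (ask C.inputAlphabet C.outputAlphabet).seq <|
    (pushSym C.tm .u₁ (.bit false)).seq <| (sub C.tm .num .u₁ .fac).seq (clear C.tm .u₁),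
    C.time.comp (25 * Polynomial.X + 5) + (3 * (25 * Polynomial.X + 5) + 30 * arithPoly),
    fun k M s hM hM2 hk hs hnum hfac => ?_⟩
  have hI := TwoItemJRP.isAperiodicInstance_aperiodicInstance hM2
  have hcoef := TwoItemJRP.coeffs_aperiodicInstance_le hM2
  obtain ⟨⟨q₁, q₂⟩, hq⟩ : ∃ q, q = f ⟨_, hI⟩ := ⟨_, rfl⟩
  have hopt := hf ⟨_, hI⟩
  have hout := C.outputsFun ⟨_, hI⟩
  rw [← hq] at hopt hout
  have hsum := hopt.add_le_of_aperiodic hI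
  have hlt := TwoItemJRP.sum_coeffs_lt hk hcoef
  have hlen := TwoItemJRP.length_encodeNats_coeffs_le hk hcoef
  have hq₁ : q₁ ≠ 0 := hopt.1.ne'
  have hw : numWord (2 * q₁) = .bit false :: numWord q₁ := numWord_bit false q₁ (.inl hq₁)
  simp only at hopt hsum
  have h2q : 2 * q₁ < 2 ^ (5 * k + 4) := by omega
  have hkM : M < 2 ^ (5 * k + 4) :=
    hk.trans_le (Nat.pow_le_pow_right (by norm_num) (by omega))
  refine ⟨if 2 * q₁ ≤ M then M - 2 * q₁ else M, ?_, ?_, fun hc => ?_, ?_⟩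
  · obtain ⟨l, hl⟩ := hM
    split_ifs <;> omega
  · split_ifs <;> omega
  · obtain ⟨-, h1, h2, h3⟩ := hopt.of_aperiodicInstance hM hc
    rw [if_pos (by omega), show M - 2 * q₁ = Nat.gcd q₁ M by omega]
    exact ⟨Nat.gcd_dvd_right _ _, h1, h2⟩
  · have hclean := hs.1
    have hs' := hs.2
    refine (Exec.seq (exec_writeAperiodic hM hM2 hk hs hnum) <|
      Exec.seq (exec_ask (k := 5 * k + 4) (by omega) (by omega) hout hs) <|
      Exec.seq (exec_pushSym _ _ _) <|
      Exec.seq (exec_sub (m := M) (n := 2 * q₁) rfl rfl rfl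
        (by repeat' first | exact hclean | refine Clean.update ?_ rfl _) hkM h2q (by simp [hnum])
        (by simp [hw]) (by simp [hfac])) <|
      exec_clear_num h2q (by simp [hw])).congr ?_ ?_
    · funext v
      cases v <;> simp [hs']
    · have e1 := C.time.eval_le_eval_nat hlen
      have e2 := arithTime_mono (k := 5 * k) (l := 5 * k + 4) (by omega)
      have e3 := one_le_arithTime (5 * k + 4)
      simp only [Polynomial.eval_add, Polynomial.eval_comp, Polynomial.eval_mul,
        Polynomial.eval_ofNat, Polynomial.eval_X, eval_arithPoly]
      omega

/-- A polynomial time algorithm for the periodic problem yields a divisor finder: the divisor is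
`q₁`. -/
theorem exists_isDivisorFinder_of_periodic (H : TwoItemJRP.PeriodicInPolyTime) :
    ∃ (tm : FinTM2) (F : Prog tm Reg) (p : Polynomial ℕ), IsDivisorFinder F p := by
  obtain ⟨f, ⟨C⟩, hf⟩ := H
  refine ⟨C.tm, (writePeriodic C.tm).seq <| (ask C.inputAlphabet C.outputAlphabet).seq <|
    (copy C.tm .u₁ .fac).seq (clear C.tm .u₁),
    C.time.comp (25 * Polynomial.X + 5) + (3 * (25 * Polynomial.X + 5) + 30 * arithPoly),
    fun k M s hM hM2 hk hs hnum hfac => ?_⟩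
  have hI := TwoItemJRP.isPeriodicInstance_periodicInstance (M := M) (by omega)
  have hcoef := TwoItemJRP.coeffs_periodicInstance_le hM2
  obtain ⟨⟨q₁, q₂⟩, hq⟩ : ∃ q, q = f ⟨_, hI⟩ := ⟨_, rfl⟩
  have hopt := hf ⟨_, hI⟩
  have hout := C.outputsFun ⟨_, hI⟩
  rw [← hq] at hopt hout
  have hsum := hopt.add_le_of_periodic hI
  have hlt := TwoItemJRP.sum_coeffs_lt hk hcoef
  have hlen := TwoItemJRP.length_encodeNats_coeffs_le hk hcoef
  simp only at hopt hsum
  have hqk : q₁ < 2 ^ (5 * k + 4) := by omega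
  refine ⟨q₁, hopt.1, hqk, fun hc => ?_, ?_⟩
  · obtain ⟨-, h1, h2, h3⟩ := hopt.of_periodicInstance hM hc
    rw [h3]
    exact ⟨Nat.gcd_dvd_right _ _, h1, h2⟩
  · have hclean := hs.1
    have hs' := hs.2
    refine (Exec.seq (exec_writePeriodic hM2 hk hs hnum) <|
      Exec.seq (exec_ask (k := 5 * k + 4) hqk (by omega) hout hs) <|
      Exec.seq (exec_copy_num hqk (by simp) (by simp) (by simp) (by simp)
        (by repeat' first | exact hclean | refine Clean.update ?_ rfl _) (by simp [hfac])) <|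
      exec_clear_num hqk (by simp)).congr ?_ ?_
    · funext v
      cases v <;> simp [hs']
    · have e1 := C.time.eval_le_eval_nat hlen
      have e2 := arithTime_mono (k := 5 * k) (l := 5 * k + 4) (by omega)
      simp only [Polynomial.eval_add, Polynomial.eval_comp, Polynomial.eval_mul,
        Polynomial.eval_ofNat, Polynomial.eval_X, eval_arithPoly]
      omega

end Prog

/-! ### Splitting numbers and testing primality -/

namespace Prog

variable {tm : FinTM2}

/-- Split the number in `num` by means of the divisor finder `F`: put a nontrivial divisor into
`fac` and its cofactor into `cof`. If the candidate found (which is `2` for an even number) fails to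
be a nontrivial divisor, the number is a prime, and `fac` and `cof` are left empty. -/
noncomputable def split (F : Prog tm Reg) : Prog tm Reg :=
  (ite (fun τ => bitOf (τ .num)) F
    ((pushSym tm .fac (.bit true)).seq (pushSym tm .fac (.bit false)))).seq <|
  (divMod tm .num .fac .cof .rem).seq <| (copy tm .cof .u₁).seq <| (popSym tm .u₁).seq <|
  (copy tm .fac .u₂).seq <| (popSym tm .u₂).seq <|
  ite (fun τ => (τ .rem).isNone && (τ .u₁).isSome && (τ .u₂).isSome)
    ((clear tm .u₁).seq (clear tm .u₂))
    ((clear tm .u₁).seq <| (clear tm .u₂).seq <| (clear tm .rem).seq <| (clear tm .fac).seq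
      (clear tm .cof))

/-- The first part of `split` finds a candidate that is a nontrivial divisor of each composite
number. -/
theorem IsDivisorFinder.exec_ite {F : Prog tm Reg} {p : Polynomial ℕ} (hF : IsDivisorFinder F p)
    {k M : ℕ} {s : Reg → List Γ'} (hM : 2 ≤ M) (hk : M < 2 ^ k) (hs : Idle s)
    (hnum : s .num = numWord M) (hfac : s .fac = []) :
    ∃ d, 0 < d ∧ d < 2 ^ (5 * k + 4) ∧ (IsComposite M → d ∣ M ∧ 1 < d ∧ d < M) ∧
      (ite (fun τ => bitOf (τ .num)) F
        ((pushSym tm .fac (.bit true)).seq (pushSym tm .fac (.bit false)))).Exec s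
        (update s .fac (numWord d)) (p.eval k + 3) := by
  rcases Nat.even_or_odd M with he | ho
  · refine ⟨2, by norm_num, ?_, fun hc => ⟨he.two_dvd, by norm_num, ?_⟩, ?_⟩
    · calc 2 < 2 ^ 4 := by norm_num
        _ ≤ 2 ^ (5 * k + 4) := Nat.pow_le_pow_right (by norm_num) (by omega)
    · exact lt_of_le_of_ne hM fun h => hc.2 (h ▸ Nat.prime_two)
    · refine (Exec.ite_false ?_ (Exec.seq (exec_pushSym _ _ _) (exec_pushSym _ _ _))).congr ?_
        (by omega)
      · simp [tops, hnum, Nat.even_iff.1 he]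
      · have h2 : numWord 2 = [.bit false, .bit true] := by
          rw [numWord_of_ne_zero (by norm_num)]; simp
        simp [hfac, h2]
  · obtain ⟨d, h0, hd, hdiv, hexec⟩ := hF k M s ho hM hk hs hnum hfac
    refine ⟨d, h0, hd, hdiv, (Exec.ite_true ?_ hexec).mono (by omega)⟩
    simp [tops, hnum, Nat.odd_iff.1 ho]

theorem IsDivisorFinder.exec_split {F : Prog tm Reg} {p : Polynomial ℕ} (hF : IsDivisorFinder F p)
    {k M : ℕ} {s : Reg → List Γ'} (hM : 2 ≤ M) (hk : M < 2 ^ k) (hs : Idle s)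
    (hnum : s .num = numWord M) (hfac : s .fac = []) (hcof : s .cof = []) (hrem : s .rem = []) :
    ∃ s', (split F).Exec s s' (p.eval k + 15 * arithTime (5 * k + 4)) ∧
      ((∃ d, 1 < d ∧ d < M ∧ d ∣ M ∧
          s' = update (update s .fac (numWord d)) .cof (numWord (M / d))) ∨
        M.Prime ∧ s' = s) := by
  obtain ⟨d, h0, hd, hdiv, hexec⟩ := hF.exec_ite hM hk hs hnum hfac
  obtain ⟨hc, hs⟩ := hs
  have bM : M < 2 ^ (5 * k + 4) := hk.trans_le (Nat.pow_le_pow_right (by norm_num) (by omega))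
  have bq : M / d < 2 ^ (5 * k + 4) := (Nat.div_le_self _ _).trans_lt bM
  have br : M % d < 2 ^ (5 * k + 4) := (Nat.mod_le _ _).trans_lt bM
  have bq2 : M / d / 2 < 2 ^ (5 * k + 4) := (Nat.div_le_self _ _).trans_lt bq
  have bd2 : d / 2 < 2 ^ (5 * k + 4) := (Nat.div_le_self _ _).trans_lt hd
  have hone := one_le_arithTime (5 * k + 4)
  have hA : 3 ≤ arithTime (5 * k + 4) := by
    unfold arithTime
    have := Nat.one_le_pow 2 (5 * k + 4 + 1) (by omega)
    omega
  have key {s'} (h : (ite (fun τ => (τ .rem).isNone && (τ .u₁).isSome && (τ .u₂).isSome)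
      ((clear tm .u₁).seq (clear tm .u₂))
      ((clear tm .u₁).seq <| (clear tm .u₂).seq <| (clear tm .rem).seq <| (clear tm .fac).seq
        (clear tm .cof))).Exec (update (update (update (update (update s .fac (numWord d))
          .cof (numWord (M / d))) .rem (numWord (M % d))) .u₁ (numWord (M / d / 2)))
          .u₂ (numWord (d / 2))) s' (6 * arithTime (5 * k + 4))) :
      (split F).Exec s s' (p.eval k + 15 * arithTime (5 * k + 4)) := by
    refine (Exec.seq hexec <|
      Exec.seq (exec_divMod (m := M) (n := d) rfl rfl rfl rfl
        (by repeat' first | exact hc | refine Clean.update ?_ rfl _) bM hd (by simp [hnum])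
        (by simp) (by simp [hcof]) h0 (by simp) (by simp [hrem])) <|
      Exec.seq (exec_copy_num bq (by simp) (by simp) (by simp) (by simp)
        (by repeat' first | exact hc | refine Clean.update ?_ rfl _) (by simp [hs])) <|
      Exec.seq ((exec_popSym _ _).mono hone) <|
      Exec.seq (exec_copy_num hd (by simp) (by simp) (by simp) (by simp)
        (by repeat' first | exact hc | refine Clean.update ?_ rfl _) (by simp [hs])) <|
      Exec.seq ((exec_popSym _ _).mono hone) (t₂ := 6 * arithTime (5 * k + 4)) ?_).mono (by omega)
    convert h using 1
    funext v
    cases v <;> simp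
  by_cases htest : M % d = 0 ∧ 1 < M / d ∧ 1 < d
  · obtain ⟨h1, h2, h3⟩ := htest
    refine ⟨_, key ((Exec.ite_true ?_ (Exec.seq (exec_clear_num bq2 (by simp))
      (exec_clear_num bd2 (by simp)))).mono (by omega)), .inl ⟨d, by omega, ?_,
      Nat.dvd_of_mod_eq_zero h1, ?_⟩⟩
    · simp [tops, h1, List.head?_eq_none_iff, Option.isSome_iff_ne_none, h3, h2]
    · have := Nat.div_mul_le_self M d
      nlinarith
    · funext v
      cases v <;> simp [hs, h1, hrem]
  · have hp : M.Prime := by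
      by_contra hp
      obtain ⟨⟨c, hc⟩, h1, h2⟩ := hdiv ⟨hM, hp⟩
      refine htest ⟨by simp [hc], ?_, h1⟩
      rw [hc, Nat.mul_div_cancel_left _ h0]
      by_contra! h
      nlinarith
    refine ⟨_, key ((Exec.ite_false ?_ <| Exec.seq (exec_clear_num bq2 (by simp)) <|
      Exec.seq (exec_clear_num bd2 (by simp)) <| Exec.seq (exec_clear_num br (by simp)) <|
      Exec.seq (exec_clear_num hd (by simp)) (exec_clear_num bq (by simp))).mono (by omega)),
      .inr ⟨hp, ?_⟩⟩
    · rw [Bool.eq_false_iff]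
      contrapose! htest
      simpa [tops, List.head?_eq_none_iff, Option.isSome_iff_ne_none, and_assoc] using htest
    · funext v
      cases v <;> simp [hs, hfac, hcof, hrem]

end Prog

theorem lt_two_pow_length_encodeNats (n : ℕ) : n < 2 ^ (encodeNats [n]).length := by
  refine (lt_two_pow_length_numWord n).trans_le (Nat.pow_le_pow_right (by norm_num) ?_)
  simp [encodeNats_cons]

namespace Prog

variable {tm : FinTM2}

theorem idle_update_input (w : List Γ') : Idle (update (fun _ => []) .input w) :=
  ⟨fun r hr => by cases r <;> simp_all [Reg.isScratch], by simp⟩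

theorem Idle.update {s : Reg → List Γ'} (hs : Idle s) {r : Reg} (w : List Γ')
    (hr : r = .input ∨ r = .output ∨ r = .num ∨ r = .fac ∨ r = .cof ∨ r = .rem ∨ r = .rest ∨
      r = .flag) : Idle (update s r w) := by
  rcases hr with rfl | rfl | rfl | rfl | rfl | rfl | rfl | rfl <;>
  exact ⟨hs.1.update rfl w, by simpa using hs.2⟩

theorem exec_parse_input {M k : ℕ} (hk : M < 2 ^ k) {r : Reg} (hr : r ≠ .input) (hr' : r ≠ .lx) :
    (parse tm .input r).Exec (update (fun _ => []) .input (encodeNats [M]))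
      (update (fun _ => []) r (numWord M)) (arithTime k) := by
  refine (exec_parse (n := M) (l := []) hr hr' (by simp) (by simp) (by simp [hr])
    (by simp [encodeNats_cons, encodeNats_nil])).congr ?_ ?_
  · simp
  · have := length_numWord_le hk
    unfold arithTime
    nlinarith

/-- A divisor finder yields a polynomial time algorithm that splits composite numbers. -/
theorem IsDivisorFinder.splittingInPolyTime {F : Prog tm Reg} {p : Polynomial ℕ}
    (hF : IsDivisorFinder F p) : SplittingInPolyTime := by
  refine polyTimeSolvable_of_exec ((parse tm .input .num).seq <| (split F).seq <|
    (emit tm .cof .output).seq <| (emit tm .fac .output).seq <| (clear tm .num).seq <|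
    (clear tm .fac).seq (clear tm .cof)) .input .output (p + 25 * arithPoly) fun M hM => ?_
  obtain ⟨k, hk⟩ : ∃ k, k = (encodeNats [M]).length := ⟨_, rfl⟩
  have hMk : M < 2 ^ k := hk ▸ lt_two_pow_length_encodeNats M
  have bM : M < 2 ^ (5 * k + 4) := hMk.trans_le (Nat.pow_le_pow_right (by norm_num) (by omega))
  have hidle : Idle (Function.update (fun _ => []) .num (numWord M)) := by
    simpa using (idle_update_input []).update (r := .num) (numWord M) (by simp)
  have hc := hidle.1
  obtain ⟨s', hexec, ⟨d, h1, h2, h3, rfl⟩ | ⟨hp, -⟩⟩ :=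
    hF.exec_split (k := k) hM.1 hMk hidle (by simp) (by simp) (by simp) (by simp)
  · have bd : d < 2 ^ (5 * k + 4) := h2.trans bM
    have bq : M / d < 2 ^ (5 * k + 4) := (Nat.div_le_self _ _).trans_lt bM
    refine ⟨(d, M / d), ⟨Nat.mul_div_cancel' h3, h2, Nat.div_lt_self (by omega) h1⟩,
      (Exec.seq (exec_parse_input bM (by simp) (by simp)) <| Exec.seq hexec <|
      Exec.seq (exec_emit_num bq (by simp) (by simp) (by simp) (by simp)
        (by repeat' first | exact hc | refine Clean.update ?_ rfl _)) <|
      Exec.seq (exec_emit_num bd (by simp) (by simp) (by simp) (by simp)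
        (by repeat' first | exact hc | refine Clean.update ?_ rfl _)) <|
      Exec.seq (exec_clear_num bM (by simp)) <| Exec.seq (exec_clear_num bd (by simp))
      (exec_clear_num bq (by simp))).congr ?_ ?_⟩
    · funext v
      cases v <;> simp [encodeNats_cons, encodeNats_nil]
    · rw [← hk]
      simp only [Polynomial.eval_add, Polynomial.eval_mul, Polynomial.eval_ofNat, eval_arithPoly]
      omega
  · exact (hM.2 hp).elim

end Prog

/-! ### Full factorization -/

theorem encodeNats_append (l l' : List ℕ) : encodeNats (l ++ l') = encodeNats l ++ encodeNats l' :=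
  List.flatMap_append

namespace Prog

variable {tm : FinTM2}

/-- Descend from the number `≥ 2` in `fac` to one of its prime divisors, which ends up in `num`: as
long as a proper divisor is found, continue with it. -/
noncomputable def findPrime (F : Prog tm Reg) : Prog tm Reg :=
  loop (fun τ => (τ .fac).isSome) <| (clear tm .num).seq <| (copy tm .fac .num).seq <|
    (clear tm .fac).seq <| (clear tm .cof).seq (split F)

theorem IsDivisorFinder.exec_findPrime {F : Prog tm Reg} {p : Polynomial ℕ}
    (hF : IsDivisorFinder F p) {k : ℕ} (j : ℕ) {d m c : ℕ} {s : Reg → List Γ'} (hd2 : 2 ≤ d)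
    (hdj : d < 2 ^ j) (hd : d < 2 ^ k) (hm : m < 2 ^ k) (hck : c < 2 ^ k) (hs : Idle s)
    (hfac : s .fac = numWord d) (hnum : s .num = numWord m) (hcof : s .cof = numWord c)
    (hrem : s .rem = []) :
    ∃ q, q.Prime ∧ q ∣ d ∧ (findPrime F).Exec s
      (update (update (update s .num (numWord q)) .fac []) .cof [])
      (j * (p.eval k + 20 * arithTime (5 * k + 4)) + 1) := by
  induction j generalizing d m c s with
  | zero => omega
  | succ j ih =>
    have hc := hs.1
    have hle : ∀ {a}, a < 2 ^ k → a < 2 ^ (5 * k + 4) := fun h =>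
      h.trans_le (Nat.pow_le_pow_right (by norm_num) (by omega))
    have hone := one_le_arithTime (5 * k + 4)
    obtain ⟨s₁, hs₁⟩ : ∃ s₁, s₁ = update (update (update s .num (numWord d)) .fac []) .cof [] :=
      ⟨_, rfl⟩
    have hidle : Idle s₁ := by
      rw [hs₁]
      exact ((hs.update _ (by simp)).update _ (by simp)).update _ (by simp)
    obtain ⟨s', hexec, hor⟩ := hF.exec_split (k := k) hd2 hd hidle (by simp [hs₁])
      (by simp [hs₁]) (by simp [hs₁]) (by simp [hs₁, hrem])
    have htop : (tops s .fac).isSome = true := by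
      simp [tops, hfac, List.head?_eq_none_iff, Option.isSome_iff_ne_none]; omega
    have hbody : ((clear tm .num).seq <| (copy tm .fac .num).seq <|
        (clear tm .fac).seq <| (clear tm .cof).seq (split F)).Exec s s'
        (p.eval k + 19 * arithTime (5 * k + 4)) := by
      refine (Exec.seq (exec_clear_num (hle hm) hnum) <|
        Exec.seq (exec_copy_num (hle hd) (by simp [hfac]) (by simp) (by simp) (by simp)
          (by repeat' first | exact hc | refine Clean.update ?_ rfl _) (by simp)) <|
        Exec.seq (exec_clear_num (hle hd) (by simp [hfac])) <|
        Exec.seq (exec_clear_num (hle hck) (by simp [hcof]))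
        (s₂ := s') (t₂ := p.eval k + 15 * arithTime (5 * k + 4)) ?_).mono (by omega)
      convert hexec using 1
      rw [hs₁]
      simp
    rcases hor with ⟨e, h1, h2, ⟨f, hf⟩, rfl⟩ | ⟨hp, rfl⟩
    · have hfe : d / e = f := by rw [hf, Nat.mul_div_cancel_left _ (by omega)]
      have hf2 : 2 ≤ f := by
        by_contra! h
        nlinarith
      have hej : e < 2 ^ j := by
        rw [pow_succ] at hdj
        nlinarith
      have hfd : f ≤ d := hfe ▸ Nat.div_le_self _ _
      obtain ⟨q, hq, hqe, hrun⟩ := ih (m := d) (c := f) h1 hej (h2.trans hd) hd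
        (hfd.trans_lt hd) (s := update (update s₁ .fac (numWord e)) .cof (numWord (d / e)))
        ((hidle.update _ (by simp)).update _ (by simp)) (by simp) (by simp [hs₁])
        (by simp [hfe]) (by simp [hs₁, hrem])
      refine ⟨q, hq, hqe.trans ⟨f, hf⟩, (Exec.loop_true htop hbody hrun).congr ?_ ?_⟩
      · rw [hs₁]
        funext v
        cases v <;> simp
      · rw [Nat.succ_mul j]
        omega
    · refine ⟨d, hp, dvd_rfl, (Exec.loop_true htop hbody (Exec.loop_false ?_)).congr hs₁ ?_⟩
      · simp [tops, hs₁]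
      · rw [Nat.succ_mul j]
        have := Nat.zero_le (j * (p.eval k + 20 * arithTime (5 * k + 4)))
        omega

/-- Output a prime divisor of the number `≥ 2` in `rest`, and divide the number by it. The register
`flag` holds half of the number, so that it is empty once the number is `1`. -/
noncomputable def extractPrime (F : Prog tm Reg) : Prog tm Reg :=
  (copy tm .rest .fac).seq <| (findPrime F).seq <| (emit tm .num .output).seq <|
  (divMod tm .rest .num .cof .rem).seq <| (clear tm .rest).seq <| (copy tm .cof .rest).seq <|
  (clear tm .cof).seq <| (clear tm .num).seq <| (clear tm .flag).seq <|
  (copy tm .rest .flag).seq (popSym tm .flag)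

theorem IsDivisorFinder.exec_extractPrime {F : Prog tm Reg} {p : Polynomial ℕ}
    (hF : IsDivisorFinder F p) {k r : ℕ} {s : Reg → List Γ'} (hr2 : 2 ≤ r) (hr : r < 2 ^ k)
    (hs : Idle s) (hfac : s .fac = []) (hnum : s .num = []) (hcof : s .cof = [])
    (hrem : s .rem = []) (hrest : s .rest = numWord r) (hflag : s .flag = numWord (r / 2)) :
    ∃ q, q.Prime ∧ q ∣ r ∧ (extractPrime F).Exec s
      (update (update (update s .output (numWord q ++ .comma :: s .output))
        .rest (numWord (r / q))) .flag (numWord (r / q / 2)))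
      (k * (p.eval k + 20 * arithTime (5 * k + 4)) + 11 * arithTime (5 * k + 4)) := by
  have hc := hs.1
  have hle : ∀ {a}, a < 2 ^ k → a < 2 ^ (5 * k + 4) := fun h =>
    h.trans_le (Nat.pow_le_pow_right (by norm_num) (by omega))
  have hone := one_le_arithTime (5 * k + 4)
  obtain ⟨q, hq, hqr, hexec⟩ := hF.exec_findPrime (k := k) k (d := r) (m := 0) (c := 0)
    (s := update s .fac (numWord r)) hr2 hr hr (by positivity) (by positivity)
    (hs.update _ (by simp)) (by simp) (by simp [hnum]) (by simp [hcof]) (by simp [hrem])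
  have br := hle hr
  have bq : q < 2 ^ (5 * k + 4) := (Nat.le_of_dvd (by omega) hqr).trans_lt br
  have bd : r / q < 2 ^ (5 * k + 4) := (Nat.div_le_self _ _).trans_lt br
  have bf : r / 2 < 2 ^ (5 * k + 4) := (Nat.div_le_self _ _).trans_lt br
  have hmod : r % q = 0 := Nat.mod_eq_zero_of_dvd hqr
  refine ⟨q, hq, hqr, (Exec.seq (exec_copy_num br hrest (by simp) (by simp) (by simp) hc hfac) <|
    Exec.seq hexec <|
    Exec.seq (exec_emit_num bq (by simp) (by simp) (by simp) (by simp)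
      (by repeat' first | exact hc | refine Clean.update ?_ rfl _)) <|
    Exec.seq (exec_divMod (m := r) (n := q) rfl rfl rfl rfl
      (by repeat' first | exact hc | refine Clean.update ?_ rfl _) br bq (by simp [hrest])
      (by simp) (by simp) hq.pos (by simp) (by simp [hrem])) <|
    Exec.seq (exec_clear_num br (by simp [hrest])) <|
    Exec.seq (exec_copy_num bd (by simp) (by simp) (by simp) (by simp)
      (by repeat' first | exact hc | refine Clean.update ?_ rfl _) (by simp)) <|
    Exec.seq (exec_clear_num bd (by simp)) <|
    Exec.seq (exec_clear_num bq (by simp)) <|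
    Exec.seq (exec_clear_num bf (by simp [hflag])) <|
    Exec.seq (exec_copy_num bd (by simp) (by simp) (by simp) (by simp)
      (by repeat' first | exact hc | refine Clean.update ?_ rfl _) (by simp))
    ((exec_popSym _ _).mono hone)).congr ?_ (by omega)⟩
  funext v
  cases v <;> simp [hnum, hfac, hcof, hrem, hmod]

theorem IsDivisorFinder.exec_loop_extractPrime {F : Prog tm Reg} {p : Polynomial ℕ}
    (hF : IsDivisorFinder F p) {k : ℕ} (j : ℕ) {r : ℕ} {s : Reg → List Γ'} (hr0 : 0 < r)
    (hrj : r < 2 ^ j) (hr : r < 2 ^ k) (hs : Idle s) (hfac : s .fac = []) (hnum : s .num = [])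
    (hcof : s .cof = []) (hrem : s .rem = []) (hrest : s .rest = numWord r)
    (hflag : s .flag = numWord (r / 2)) :
    ∃ l : List ℕ, (∀ q ∈ l, q.Prime) ∧ l.prod = r ∧
      (loop (fun τ => (τ .flag).isSome) (extractPrime F)).Exec s
        (update (update (update s .output (encodeNats l ++ s .output)) .rest (numWord 1)) .flag [])
        (j * (k * (p.eval k + 20 * arithTime (5 * k + 4)) + 12 * arithTime (5 * k + 4)) + 1) := by
  induction j generalizing r s with
  | zero => omega
  | succ j ih =>
    by_cases h1 : r = 1
    · subst h1
      refine ⟨[], by simp, by simp, (Exec.loop_false ?_).congr ?_ (by omega)⟩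
      · simp [tops, hflag]
      · funext v
        cases v <;> simp [encodeNats_nil, hrest, hflag]
    · have hone := one_le_arithTime (5 * k + 4)
      obtain ⟨q, hq, ⟨c, rfl⟩, hexec⟩ :=
        hF.exec_extractPrime (k := k) (by omega) hr hs hfac hnum hcof hrem hrest hflag
      have hdiv : q * c / q = c := Nat.mul_div_cancel_left _ hq.pos
      rw [hdiv] at hexec
      have hq2 := hq.two_le
      have hcle : c ≤ q * c := Nat.le_mul_of_pos_left _ hq.pos
      have hcj : c < 2 ^ j := by
        rw [pow_succ] at hrj
        nlinarith
      obtain ⟨s₁, hs₁⟩ : ∃ s₁, s₁ = update (update (update s .output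
        (numWord q ++ .comma :: s .output)) .rest (numWord c)) .flag (numWord (c / 2)) := ⟨_, rfl⟩
      rw [← hs₁] at hexec
      obtain ⟨l, hl, hprod, hrun⟩ := ih (s := s₁) (Nat.pos_of_mul_pos_left hr0) hcj
        (hcle.trans_lt hr)
        (hs₁ ▸ ((hs.update _ (by simp)).update _ (by simp)).update _ (by simp)) (by simp [hs₁, hfac])
        (by simp [hs₁, hnum]) (by simp [hs₁, hcof]) (by simp [hs₁, hrem]) (by simp [hs₁])
        (by simp [hs₁])
      refine ⟨l ++ [q], ?_, by simp [hprod, mul_comm], (Exec.loop_true ?_ hexec hrun).congr ?_ ?_⟩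
      · simpa [or_imp, forall_and] using ⟨hl, hq⟩
      · simp [tops, hflag, List.head?_eq_none_iff, Option.isSome_iff_ne_none]; omega
      · rw [hs₁]
        funext v
        cases v <;> simp [encodeNats_append, encodeNats_cons, encodeNats_nil]
      · rw [Nat.succ_mul j]
        omega

/-- A divisor finder yields a polynomial time algorithm that factors numbers into primes. -/
theorem IsDivisorFinder.primeFactorizationInPolyTime {F : Prog tm Reg} {p : Polynomial ℕ}
    (hF : IsDivisorFinder F p) : PrimeFactorizationInPolyTime := by
  refine polyTimeSolvable_of_exec ((parse tm .input .rest).seq <| (copy tm .rest .flag).seq <|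
    (popSym tm .flag).seq <| (loop (fun τ => (τ .flag).isSome) (extractPrime F)).seq
    (clear tm .rest)) .input .output
    (Polynomial.X * (Polynomial.X * (p + 20 * arithPoly) + 12 * arithPoly) + 5 * arithPoly)
    fun M hM => ?_
  obtain ⟨k, hk⟩ : ∃ k, k = (encodeNats [M]).length := ⟨_, rfl⟩
  have hMk : M < 2 ^ k := hk ▸ lt_two_pow_length_encodeNats M
  have bM : M < 2 ^ (5 * k + 4) := hMk.trans_le (Nat.pow_le_pow_right (by norm_num) (by omega))
  have bone : 1 < 2 ^ (5 * k + 4) := by omega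
  have hone := one_le_arithTime (5 * k + 4)
  have hidle : Idle (Function.update (Function.update (fun _ => []) .rest (numWord M)) .flag
      (numWord (M / 2))) := by
    simpa using ((idle_update_input []).update (r := .rest) (numWord M) (by simp)).update
      (r := .flag) (numWord (M / 2)) (by simp)
  have hc : Clean (Function.update (fun _ => []) Reg.rest (numWord M)) :=
    Clean.update (fun _ _ => rfl) rfl _
  obtain ⟨l, hl, hprod, hexec⟩ := hF.exec_loop_extractPrime (k := k) k hM hMk hMk hidle (by simp)
    (by simp) (by simp) (by simp) (by simp) (by simp)
  refine ⟨l, ⟨hl, hprod⟩, (Exec.seq (exec_parse_input bM (by simp) (by simp)) <|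
    Exec.seq (exec_copy_num bM (by simp) (by simp) (by simp) (by simp) hc (by simp)) <|
    Exec.seq ((exec_popSym _ _).mono hone) <|
    Exec.seq (s₁ := ?_) (t₁ := ?_) ?_ (exec_clear_num bone ?_)).congr ?_ ?_⟩
  rotate_left 2
  · convert hexec using 1
    simp
  · simp
  · funext v
    cases v <;> simp
  · rw [← hk]
    simp only [Polynomial.eval_add, Polynomial.eval_mul, Polynomial.eval_ofNat, Polynomial.eval_X,
      eval_arithPoly]
    omega

theorem IsDivisorFinder.integerFactorizationInPolyTime {F : Prog tm Reg} {p : Polynomial ℕ}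
    (hF : IsDivisorFinder F p) : IntegerFactorizationInPolyTime :=
  ⟨hF.splittingInPolyTime, hF.primeFactorizationInPolyTime⟩

end Prog

/-! ### Conclusion -/

theorem theorem1 :
    -- (a) the aperiodic problem
    ((TwoItemJRP.AperiodicInPolyTime → IntegerFactorizationInPolyTime) ∧
      ∀ M : ℕ, Odd M → IsComposite M →
        (TwoItemJRP.aperiodicInstance M).IsAperiodicInstance ∧
        (TwoItemJRP.aperiodicInstance M).SizeBound M ∧
        TwoItemJRP.ForcesDivisor (TwoItemJRP.aperiodicInstance M).aperiodicCost M) ∧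
    -- (b) the periodic problem
    ((TwoItemJRP.PeriodicInPolyTime → IntegerFactorizationInPolyTime) ∧
      ∀ M : ℕ, Odd M → IsComposite M →
        (TwoItemJRP.periodicInstance M).IsPeriodicInstance ∧
        (TwoItemJRP.periodicInstance M).SizeBound M ∧
        TwoItemJRP.ForcesDivisor (TwoItemJRP.periodicInstance M).periodicCost M) := by
  refine ⟨⟨fun H => ?_, fun M hM hc => ⟨?_, ?_, ?_⟩⟩, fun H => ?_, fun M hM hc => ⟨?_, ?_, ?_⟩⟩
  · obtain ⟨tm, F, p, hF⟩ := Prog.exists_isDivisorFinder_of_aperiodic H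
    exact hF.integerFactorizationInPolyTime
  · exact TwoItemJRP.isAperiodicInstance_aperiodicInstance hc.1
  · exact TwoItemJRP.sizeBound_of_le_pow hc.1 (TwoItemJRP.coeffs_aperiodicInstance_le hc.1)
  · exact TwoItemJRP.forcesDivisor_aperiodicInstance hM hc
  · obtain ⟨tm, F, p, hF⟩ := Prog.exists_isDivisorFinder_of_periodic H
    exact hF.integerFactorizationInPolyTime
  · exact TwoItemJRP.isPeriodicInstance_periodicInstance (by linarith [hc.1])
  · exact TwoItemJRP.sizeBound_of_le_pow hc.1 (TwoItemJRP.coeffs_periodicInstance_le hc.1)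
  · exact TwoItemJRP.forcesDivisor_periodicInstance hM hc
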